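/- Let $\delta>0$ and let $\xi_1,\xi_2,\dots$ be i.i.d. random vectors with values in $\mathbb Z^2$, with $\mathbb E|\xi_1|^{2+\delta}<\infty$, mean $0$ and covariance matrix the identity, symmetric ($-\xi_1$ has the same law as $\xi_1$) and strongly aperiodic (for every $x\in\mathbb Z^2$ the set $\{x+y:\mathbb P(\xi_1=y)>0\}$ generates the group $\mathbb Z^2$); $|\cdot|$ is the Euclidean norm. Let $X_n=\xi_1+\dots+\xi_n$, let $p(n,0,x)=\mathbb P(X_n=x)$, and let $e_1=(1,0)$. Then for every $x\in\mathbb Z^2$ the series $$G(x)=\sum_{n=1}^\infty\,[p(n,0,x)-p(n,0,e_1)]$$ converges absolutely, and there is a constant $\kappa\in\mathbb R$ such that for every real $\rho<\delta/2$ with $\rho\le 2$, $$G(x)=\kappa+\frac1\pi\log\frac1{|x|}+O(|x|^{-\rho}),\qquad x\in\mathbb Z^2\setminus\{0\},$$ that is, for some constant $C$ (depending on $\rho$ and on the law of $\xi_1$, but not on $x$) the difference of the two sides without the error term is at most $C|x|^{-\rho}$ in absolute value for all $x\in\mathbb Z^2\setminus\{0\}$. (The condition $\rho\le2$ is automatic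 when $\delta\le4$.) -/

import Mathlib

open MeasureTheory ProbabilityTheory

noncomputable section

namespace PlanarWalk

variable {Ω : Type*}

/-- Euclidean norm of a point of `ℤ²` (the norm that Mathlib puts on `ℤ × ℤ` is the sup norm). -/
def euclNorm (x : ℤ × ℤ) : ℝ := Real.sqrt ((x.1 : ℝ) ^ 2 + (x.2 : ℝ) ^ 2)

/-- The unit vector `e₁ = (1, 0)`. -/
def e₁ : ℤ × ℤ := (1, 0)

/-- The random walk started at the origin: the sum of the first `n` steps
(the steps are numbered from `0`). -/
def walk (ξ : ℕ → Ω → ℤ × ℤ) (n : ℕ) (ω : Ω) : ℤ × ℤ := ∑ i ∈ Finset.range n, ξ i ω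

variable [MeasurableSpace Ω]

/-- The `n`-step transition probability `p(n, x, y)` of the random walk with steps `ξ`. -/
def transProb (P : Measure Ω) (ξ : ℕ → Ω → ℤ × ℤ) (n : ℕ) (x y : ℤ × ℤ) : ℝ :=
  P.real {ω | x + walk ξ n ω = y}

/-- The term `p(n, 0, x) - p(n, 0, e₁)` of the potential kernel. -/
def kernelTerm (P : Measure Ω) (ξ : ℕ → Ω → ℤ × ℤ) (x : ℤ × ℤ) (n : ℕ) : ℝ :=
  transProb P ξ n 0 x - transProb P ξ n 0 e₁

/-- The potential kernel `G(x) = ∑_{n ≥ 1} [p(n, 0, x) - p(n, 0, e₁)]`. -/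
def potentialKernel (P : Measure Ω) (ξ : ℕ → Ω → ℤ × ℤ) (x : ℤ × ℤ) : ℝ :=
  ∑' n : ℕ, kernelTerm P ξ x (n + 1)

/-- The covariance matrix of a random vector with values in `ℤ²` is the identity. -/
def HasIdentityCovariance (P : Measure Ω) (Y : Ω → ℤ × ℤ) : Prop :=
  covariance (fun ω => ((Y ω).1 : ℝ)) (fun ω => ((Y ω).1 : ℝ)) P = 1 ∧
  covariance (fun ω => ((Y ω).2 : ℝ)) (fun ω => ((Y ω).2 : ℝ)) P = 1 ∧
  covariance (fun ω => ((Y ω).1 : ℝ)) (fun ω => ((Y ω).2 : ℝ)) P = 0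

/-- A random vector with values in `ℤ²` is symmetric: `Y` and `-Y` have the same law. -/
def IsSymmetric (P : Measure Ω) (Y : Ω → ℤ × ℤ) : Prop :=
  IdentDistrib (fun ω => -Y ω) Y P P

/-- Strong aperiodicity (Spitzer's definition) of the random walk on `ℤ²` whose steps are
distributed as `Y`: no translate of the set of possible steps lies in a proper subgroup. -/
def StronglyAperiodic (P : Measure Ω) (Y : Ω → ℤ × ℤ) : Prop :=
  ∀ x : ℤ × ℤ,
    AddSubgroup.closure {z : ℤ × ℤ | ∃ y : ℤ × ℤ, P {ω | Y ω = y} ≠ 0 ∧ z = x + y} = ⊤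

end PlanarWalk

end

/-! Let φ be the characteristic function of a step; it is real by symmetry. Fourier inversion writes
p(n,0,x) as an integral of φⁿ cos⟨θ,x⟩. The integral over the torus is unfolded to the plane against
a smooth compactly supported `bump` whose translates by 2πℤ² sum to one, so no boundary terms ever
appear. Strong aperiodicity gives 1 - |φ| ≥ c‖θ‖² on the support of the bump, while cos⟨θ,x⟩ -
cos⟨θ,e₁⟩ is O(‖θ‖²). Hence the geometric series in φ can be summed under the integral, absolutely
(`hasSum_integral_pow_mul_cos_sub_cos`). For x ≠ 0 the resulting multiplier φ/(1-φ) may be replaced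
by 1/(1-φ), since the constant 1 integrates to zero against the cosines.

With q = |θ|²/2, split bump/(1-φ) into the Gaussian model exp(-q)/q and a remainder H. The model is
computed exactly: exp(-q)/q is the integral of exp(-tq) over t > 1, which leads to an exponential
integral, hence to a logarithm, a constant and an error O(|x|⁻²)
(`exists_gaussian_kernel_asymptotics`).

The remainder is treated by a small symbol calculus. Moments of order 2+σ make 1-φ-q a symbol of
order 2+σ, and dividing twice by a symbol of order 2 leaves order σ-2, so H is a symbol of order σ-2
(`isSymbol_kernelSymbol`). Its Fourier transform is O(|x|^(-σ)): shifting θ by h with ⟨h,x⟩ = π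
flips the sign of the cosine, so the integral is controlled by k-th differences of H, estimated
trivially near the origin and by k derivatives away from it
(`IsSymbol.exists_abs_integral_cos_mul_le`). The value of this transform at e₁ is absorbed in κ. -/

namespace PlanarWalk

/-! ### Symbol calculus on the punctured plane -/

/-- Symbols of order `a` and regularity `k` on `U`: functions on the plane whose directional
derivatives of order `i ≤ k` are `O(‖θ‖ ^ (a - i))`. -/
def IsSymbol (k : ℕ) (a : ℝ) (U : Set (ℝ × ℝ)) (f : ℝ × ℝ → ℝ) : Prop :=
  ∃ C : ℝ, 0 ≤ C ∧ ∀ θ ∈ U, ∀ e : ℝ × ℝ, ContDiffAt ℝ k (fun t : ℝ => f (θ + t • e)) 0 ∧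
    ∀ i ≤ k, |iteratedDeriv i (fun t : ℝ => f (θ + t • e)) 0| ≤ C * ‖e‖ ^ i * ‖θ‖ ^ (a - i)

namespace IsSymbol

variable {k : ℕ} {a b : ℝ} {U V : Set (ℝ × ℝ)} {f g : ℝ × ℝ → ℝ}

lemma mono_set (h : IsSymbol k a U f) (hVU : V ⊆ U) : IsSymbol k a V f := by
  obtain ⟨C, hC, h⟩ := h
  exact ⟨C, hC, fun θ hθ => h θ (hVU hθ)⟩

lemma union (hU : IsSymbol k a U f) (hV : IsSymbol k a V f) : IsSymbol k a (U ∪ V) f := by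
  obtain ⟨C, hC, hU⟩ := hU
  obtain ⟨D, hD, hV⟩ := hV
  refine ⟨max C D, le_max_of_le_left hC, ?_⟩
  rintro θ (hθ | hθ) e
  · refine ⟨(hU θ hθ e).1, fun i hi => ((hU θ hθ e).2 i hi).trans ?_⟩
    gcongr
    exact le_max_left _ _
  · refine ⟨(hV θ hθ e).1, fun i hi => ((hV θ hθ e).2 i hi).trans ?_⟩
    gcongr
    exact le_max_right _ _

lemma abs_le (h : IsSymbol k a U f) : ∃ C : ℝ, 0 ≤ C ∧ ∀ θ ∈ U, |f θ| ≤ C * ‖θ‖ ^ a := by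
  obtain ⟨C, hC, h⟩ := h
  refine ⟨C, hC, fun θ hθ => ?_⟩
  simpa using (h θ hθ 0).2 0 (Nat.zero_le _)

/-- Openness is needed because the derivatives at a point of `U` see the function on a short segment
around it. -/
lemma congr_of_isOpen (h : IsSymbol k a U f) (hU : IsOpen U) (hfg : ∀ θ ∈ U, g θ = f θ) :
    IsSymbol k a U g := by
  obtain ⟨C, hC, h⟩ := h
  refine ⟨C, hC, fun θ hθ e => ?_⟩
  have hev : (fun t : ℝ => g (θ + t • e)) =ᶠ[nhds 0] fun t : ℝ => f (θ + t • e) := by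
    have hcont : ContinuousAt (fun t : ℝ => θ + t • e) 0 := by fun_prop
    have hmem : U ∈ nhds (θ + (0 : ℝ) • e) := by simpa using hU.mem_nhds hθ
    filter_upwards [hcont.preimage_mem_nhds hmem] with t ht using hfg _ ht
  refine ⟨(h θ hθ e).1.congr_of_eventuallyEq hev, fun i hi => ?_⟩
  rw [hev.iteratedDeriv_eq]
  exact (h θ hθ e).2 i hi

lemma sub (hf : IsSymbol k a U f) (hg : IsSymbol k a U g) :
    IsSymbol k a U (fun θ => f θ - g θ) := by
  obtain ⟨C, hC, hf⟩ := hf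
  obtain ⟨D, hD, hg⟩ := hg
  refine ⟨C + D, add_nonneg hC hD, fun θ hθ e => ⟨(hf θ hθ e).1.sub (hg θ hθ e).1, ?_⟩⟩
  intro i hi
  have hik : (i : WithTop ℕ∞) ≤ k := by exact_mod_cast hi
  rw [iteratedDeriv_fun_sub ((hf θ hθ e).1.of_le hik) ((hg θ hθ e).1.of_le hik)]
  refine (abs_sub _ _).trans ?_
  have h1 := (hf θ hθ e).2 i hi
  have h2 := (hg θ hθ e).2 i hi
  calc _ ≤ C * ‖e‖ ^ i * ‖θ‖ ^ (a - i) + D * ‖e‖ ^ i * ‖θ‖ ^ (a - i) := add_le_add h1 h2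
    _ = _ := by ring

lemma neg (hf : IsSymbol k a U f) : IsSymbol k a U (fun θ => -f θ) := by
  obtain ⟨C, hC, hf⟩ := hf
  refine ⟨C, hC, fun θ hθ e => ⟨(hf θ hθ e).1.neg, fun i hi => ?_⟩⟩
  rw [iteratedDeriv_fun_neg, abs_neg]
  exact (hf θ hθ e).2 i hi

lemma add (hf : IsSymbol k a U f) (hg : IsSymbol k a U g) :
    IsSymbol k a U (fun θ => f θ + g θ) := by
  simpa using hf.sub hg.neg

/-- Leibniz rule: in each term the orders of differentiation add up to `i`, so all terms have the
same size, and the binomial coefficients sum to at most `2 ^ k`. -/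
lemma mul (hU : ∀ θ ∈ U, θ ≠ 0) (hf : IsSymbol k a U f) (hg : IsSymbol k b U g) :
    IsSymbol k (a + b) U (fun θ => f θ * g θ) := by
  obtain ⟨C, hC, hf⟩ := hf
  obtain ⟨D, hD, hg⟩ := hg
  refine ⟨2 ^ k * (C * D), by positivity, fun θ hθ e =>
    ⟨(hf θ hθ e).1.mul (hg θ hθ e).1, fun i hi => ?_⟩⟩
  have hik : (i : WithTop ℕ∞) ≤ k := by exact_mod_cast hi
  have hpos : 0 < ‖θ‖ := norm_pos_iff.2 (hU θ hθ)
  rw [iteratedDeriv_fun_mul ((hf θ hθ e).1.of_le hik) ((hg θ hθ e).1.of_le hik)]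
  calc |∑ j ∈ Finset.range (i + 1), (i.choose j : ℝ) *
          iteratedDeriv j (fun t : ℝ => f (θ + t • e)) 0 *
          iteratedDeriv (i - j) (fun t : ℝ => g (θ + t • e)) 0|
      ≤ ∑ j ∈ Finset.range (i + 1), (i.choose j : ℝ) *
          (C * D * ‖e‖ ^ i * ‖θ‖ ^ (a + b - i)) := by
        refine (Finset.abs_sum_le_sum_abs _ _).trans (Finset.sum_le_sum fun j hj => ?_)
        have hji : j ≤ i := Nat.lt_succ_iff.1 (Finset.mem_range.1 hj)
        have h1 := (hf θ hθ e).2 j (hji.trans hi)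
        have h2 := (hg θ hθ e).2 (i - j) ((Nat.sub_le _ _).trans hi)
        rw [abs_mul, abs_mul, mul_assoc, Nat.abs_cast]
        refine mul_le_mul_of_nonneg_left ?_ (Nat.cast_nonneg _)
        calc _ ≤ (C * ‖e‖ ^ j * ‖θ‖ ^ (a - j)) *
              (D * ‖e‖ ^ (i - j) * ‖θ‖ ^ (b - (i - j : ℕ))) :=
              mul_le_mul h1 h2 (abs_nonneg _) (by positivity)
          _ = C * D * (‖e‖ ^ j * ‖e‖ ^ (i - j)) *
              (‖θ‖ ^ (a - j) * ‖θ‖ ^ (b - (i - j : ℕ))) := by ring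
          _ = _ := by
              rw [← pow_add, ← Real.rpow_add hpos, Nat.add_sub_cancel' hji]
              congr 2
              rw [Nat.cast_sub hji]; ring
    _ = 2 ^ i * (C * D * ‖e‖ ^ i * ‖θ‖ ^ (a + b - i)) := by
        rw [← Finset.sum_mul, ← Nat.cast_sum, Nat.sum_range_choose]; norm_num
    _ ≤ 2 ^ k * (C * D * ‖e‖ ^ i * ‖θ‖ ^ (a + b - i)) := by
        gcongr
        norm_num
    _ = _ := by ring

/-- A symbol of order `a` with a lower bound of the same order has a reciprocal of order `-a`. -/
lemma inv (hU : ∀ θ ∈ U, θ ≠ 0) (hf : IsSymbol k a U f) {c : ℝ} (hc : 0 < c)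
    (hlow : ∀ θ ∈ U, c * ‖θ‖ ^ a ≤ |f θ|) : IsSymbol k (-a) U (fun θ => (f θ)⁻¹) := by
  obtain ⟨C, hC, hf⟩ := hf
  have hne : ∀ θ ∈ U, f θ ≠ 0 := fun θ hθ h0 => by
    have := hlow θ hθ
    have hp : 0 < ‖θ‖ ^ a := Real.rpow_pos_of_pos (norm_pos_iff.2 (hU θ hθ)) a
    rw [h0, abs_zero] at this
    nlinarith
  have hcd : ∀ θ ∈ U, ∀ e : ℝ × ℝ, ContDiffAt ℝ k (fun t : ℝ => (f (θ + t • e))⁻¹) 0 :=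
    fun θ hθ e => (hf θ hθ e).1.fun_inv (by simpa using hne θ hθ)
  -- Induction with one constant for all orders up to `n`, since the Leibniz rule brings in every
  -- lower derivative of the reciprocal.
  have key : ∀ n : ℕ, n ≤ k → ∃ D : ℝ, 0 ≤ D ∧ ∀ i ≤ n, ∀ θ ∈ U, ∀ e : ℝ × ℝ,
      |iteratedDeriv i (fun t : ℝ => (f (θ + t • e))⁻¹) 0| ≤ D * ‖e‖ ^ i * ‖θ‖ ^ (-a - i) := by
    intro n
    induction n with
    | zero =>
      intro _
      refine ⟨c⁻¹, by positivity, fun i hi θ hθ e => ?_⟩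
      obtain rfl : i = 0 := by omega
      have hp : 0 < ‖θ‖ ^ a := Real.rpow_pos_of_pos (norm_pos_iff.2 (hU θ hθ)) a
      simp only [iteratedDeriv_zero, zero_smul, add_zero, pow_zero, mul_one, Nat.cast_zero,
        sub_zero, abs_inv]
      rw [Real.rpow_neg (norm_nonneg _), ← mul_inv]
      exact inv_anti₀ (by positivity) (hlow θ hθ)
    | succ n ih =>
      intro hnk
      obtain ⟨D, hD, ih⟩ := ih (by omega)
      refine ⟨D + c⁻¹ * (2 ^ (n + 1) * (C * D)), by positivity, fun i hi θ hθ e => ?_⟩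
      have hpos : 0 < ‖θ‖ := norm_pos_iff.2 (hU θ hθ)
      rcases Nat.lt_or_ge i (n + 1) with hlt | hge
      · refine (ih i (by omega) θ hθ e).trans ?_
        gcongr
        have : 0 ≤ c⁻¹ * (2 ^ (n + 1) * (C * D)) := by positivity
        linarith
      obtain rfl : i = n + 1 := by omega
      have hik : ((n + 1 : ℕ) : WithTop ℕ∞) ≤ k := by exact_mod_cast hnk
      -- Differentiating f · f⁻¹ = 1 and isolating the term with all derivatives on f⁻¹ gives the
      -- recursion.
      have hprod : iteratedDeriv (n + 1)
          (fun t : ℝ => f (θ + t • e) * (f (θ + t • e))⁻¹) 0 = 0 := by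
        have hev : (fun t : ℝ => f (θ + t • e) * (f (θ + t • e))⁻¹) =ᶠ[nhds 0] fun _ => 1 := by
          have hca : ContinuousAt (fun t : ℝ => f (θ + t • e)) 0 := (hf θ hθ e).1.continuousAt
          filter_upwards [hca.eventually_ne (by simpa using hne θ hθ)] with t ht
          exact mul_inv_cancel₀ ht
        rw [hev.iteratedDeriv_eq, iteratedDeriv_const]
        simp
      rw [iteratedDeriv_fun_mul ((hf θ hθ e).1.of_le hik) ((hcd θ hθ e).of_le hik),
        Finset.sum_range_succ'] at hprod
      simp only [Nat.choose_zero_right, Nat.cast_one, one_mul, iteratedDeriv_zero, zero_smul,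
        add_zero, Nat.sub_zero] at hprod
      have hfne := hne θ hθ
      have hsolve : iteratedDeriv (n + 1) (fun t : ℝ => (f (θ + t • e))⁻¹) 0 =
          -((f θ)⁻¹ * ∑ j ∈ Finset.range (n + 1), ((n + 1).choose (j + 1) : ℝ) *
          iteratedDeriv (j + 1) (fun t : ℝ => f (θ + t • e)) 0 *
          iteratedDeriv (n + 1 - (j + 1)) (fun t : ℝ => (f (θ + t • e))⁻¹) 0) := by
        rw [← mul_neg, ← eq_neg_of_add_eq_zero_right hprod, inv_mul_cancel_left₀ hfne]
      rw [hsolve, abs_neg, abs_mul, abs_inv]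
      have hinv : |f θ|⁻¹ ≤ c⁻¹ * ‖θ‖ ^ (-a) := by
        rw [Real.rpow_neg (norm_nonneg _), ← mul_inv]
        exact inv_anti₀ (by positivity) (hlow θ hθ)
      have hsum : |∑ j ∈ Finset.range (n + 1), ((n + 1).choose (j + 1) : ℝ) *
          iteratedDeriv (j + 1) (fun t : ℝ => f (θ + t • e)) 0 *
          iteratedDeriv (n + 1 - (j + 1)) (fun t : ℝ => (f (θ + t • e))⁻¹) 0| ≤
          2 ^ (n + 1) * (C * D * ‖e‖ ^ (n + 1) * ‖θ‖ ^ (-(n + 1 : ℕ) : ℝ)) := by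
        calc _ ≤ ∑ j ∈ Finset.range (n + 1), ((n + 1).choose (j + 1) : ℝ) *
              (C * D * ‖e‖ ^ (n + 1) * ‖θ‖ ^ (-(n + 1 : ℕ) : ℝ)) := by
              refine (Finset.abs_sum_le_sum_abs _ _).trans (Finset.sum_le_sum fun j hj => ?_)
              have hji : j + 1 ≤ n + 1 := by have := Finset.mem_range.1 hj; omega
              have h1 := (hf θ hθ e).2 (j + 1) (hji.trans hnk)
              have h2 := ih (n + 1 - (j + 1)) (by omega) θ hθ e
              rw [abs_mul, abs_mul, mul_assoc, Nat.abs_cast]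
              refine mul_le_mul_of_nonneg_left ?_ (Nat.cast_nonneg _)
              calc _ ≤ (C * ‖e‖ ^ (j + 1) * ‖θ‖ ^ (a - (j + 1 : ℕ))) *
                    (D * ‖e‖ ^ (n + 1 - (j + 1)) * ‖θ‖ ^ (-a - (n + 1 - (j + 1) : ℕ))) :=
                    mul_le_mul h1 h2 (abs_nonneg _) (by positivity)
                _ = C * D * (‖e‖ ^ (j + 1) * ‖e‖ ^ (n + 1 - (j + 1))) *
                    (‖θ‖ ^ (a - (j + 1 : ℕ)) * ‖θ‖ ^ (-a - (n + 1 - (j + 1) : ℕ))) := by ring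
                _ = _ := by
                    rw [← pow_add, ← Real.rpow_add hpos, Nat.add_sub_cancel' hji]
                    congr 2
                    rw [Nat.cast_sub hji]; ring
          _ ≤ _ := by
              rw [← Finset.sum_mul]
              gcongr
              have := Nat.sum_range_choose (n + 1)
              rw [Finset.sum_range_succ'] at this
              rw [← Nat.cast_sum]
              have h3 : (∑ i ∈ Finset.range (n + 1), (n + 1).choose (i + 1)) ≤ 2 ^ (n + 1) := by
                omega
              exact_mod_cast h3
      calc _ ≤ (c⁻¹ * ‖θ‖ ^ (-a)) *
            (2 ^ (n + 1) * (C * D * ‖e‖ ^ (n + 1) * ‖θ‖ ^ (-(n + 1 : ℕ) : ℝ))) :=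
            mul_le_mul hinv hsum (abs_nonneg _) (by positivity)
        _ = c⁻¹ * (2 ^ (n + 1) * (C * D)) * ‖e‖ ^ (n + 1) *
            (‖θ‖ ^ (-a) * ‖θ‖ ^ (-(n + 1 : ℕ) : ℝ)) := by ring
        _ = c⁻¹ * (2 ^ (n + 1) * (C * D)) * ‖e‖ ^ (n + 1) * ‖θ‖ ^ (-a - (n + 1 : ℕ)) := by
            rw [← Real.rpow_add hpos, sub_eq_add_neg]
        _ ≤ _ := by
            gcongr
            linarith
  obtain ⟨D, hD, hbound⟩ := key k le_rfl
  exact ⟨D, hD, fun θ hθ e => ⟨hcd θ hθ e, fun i hi => hbound i hi θ hθ e⟩⟩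

/-- On a bounded set the order of a symbol can be lowered. -/
lemma of_le (hU : ∀ θ ∈ U, θ ≠ 0) {R : ℝ} (hR : ∀ θ ∈ U, ‖θ‖ ≤ R) (hba : b ≤ a)
    (hf : IsSymbol k a U f) : IsSymbol k b U f := by
  obtain ⟨C, hC, hf⟩ := hf
  refine ⟨C * |R| ^ (a - b), by positivity, fun θ hθ e => ⟨(hf θ hθ e).1, fun i hi => ?_⟩⟩
  have hpos : 0 < ‖θ‖ := norm_pos_iff.2 (hU θ hθ)
  refine ((hf θ hθ e).2 i hi).trans ?_
  calc C * ‖e‖ ^ i * ‖θ‖ ^ (a - i) = C * ‖e‖ ^ i * (‖θ‖ ^ (a - b) * ‖θ‖ ^ (b - i)) := by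
        rw [← Real.rpow_add hpos]; congr 2; ring
    _ ≤ C * ‖e‖ ^ i * (|R| ^ (a - b) * ‖θ‖ ^ (b - i)) := by
        have : ‖θ‖ ≤ |R| := (hR θ hθ).trans (le_abs_self R)
        gcongr
    _ = _ := by ring

end IsSymbol

/-- Lets smoothness and all iterated derivatives be read off from formulas checked one order at a
time. -/
lemma contDiff_and_iteratedDeriv_eq {k : ℕ} {d : ℕ → ℝ → ℝ}
    (hd : ∀ i < k, ∀ t, HasDerivAt (d i) (d (i + 1) t) t) (hc : Continuous (d k)) :
    ContDiff ℝ k (d 0) ∧ ∀ i ≤ k, iteratedDeriv i (d 0) = d i := by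
  have hit : ∀ i ≤ k, iteratedDeriv i (d 0) = d i := by
    intro i
    induction i with
    | zero => intro _; exact iteratedDeriv_zero
    | succ i ih =>
      intro hi
      rw [iteratedDeriv_succ, ih (by omega)]
      exact funext fun t => (hd i (by omega) t).deriv
  refine ⟨contDiff_nat_iff_iteratedDeriv.2 ⟨fun m hm => ?_, fun m hm => ?_⟩, hit⟩
  · rw [hit m hm]
    rcases hm.lt_or_eq with hlt | rfl
    · exact continuous_iff_continuousAt.2 fun t => (hd m hlt t).continuousAt
    · exact hc
  · rw [hit m hm.le]
    exact fun t => (hd m hm t).differentiableAt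

/-- A criterion for symbols: the directional derivatives are given by explicit formulas. -/
lemma isSymbol_of_hasDerivAt {k : ℕ} {a C : ℝ} (hC : 0 ≤ C) {U : Set (ℝ × ℝ)} {f : ℝ × ℝ → ℝ}
    (D : ℕ → ℝ × ℝ → ℝ × ℝ → ℝ) (h0 : ∀ e θ, D 0 e θ = f θ)
    (hD : ∀ i < k, ∀ e θ, HasDerivAt (fun t : ℝ => D i e (θ + t • e)) (D (i + 1) e θ) 0)
    (hc : ∀ e θ, Continuous fun t : ℝ => D k e (θ + t • e))
    (hbound : ∀ i ≤ k, ∀ e, ∀ θ ∈ U, |D i e θ| ≤ C * ‖e‖ ^ i * ‖θ‖ ^ (a - i)) :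
    IsSymbol k a U f := by
  refine ⟨C, hC, fun θ hθ e => ?_⟩
  -- The hypothesis gives derivatives only at parameter 0, but for every base point; moving the base
  -- point along the line gives them at every `t`.
  have hd : ∀ i < k, ∀ t, HasDerivAt (fun t : ℝ => D i e (θ + t • e))
      (D (i + 1) e (θ + t • e)) t := by
    intro i hi t
    have h1 := hD i hi e (θ + t • e)
    have h2 : HasDerivAt (fun s : ℝ => s - t) 1 t := (hasDerivAt_id t).sub_const t
    have h3 := HasDerivAt.scomp_of_eq t h1 h2 (by simp)
    rw [one_smul] at h3
    refine h3.congr_of_eventuallyEq (Filter.Eventually.of_forall fun s => ?_)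
    simp only [Function.comp]
    congr 1
    module
  obtain ⟨h1, h2⟩ := contDiff_and_iteratedDeriv_eq
    (d := fun i t => D i e (θ + t • e)) hd (hc e θ)
  simp only [h0] at h1 h2
  refine ⟨h1.contDiffAt, fun i hi => ?_⟩
  rw [h2 i hi]
  simpa using hbound i hi e θ hθ

lemma isSymbol_const (k : ℕ) (c : ℝ) : IsSymbol k 0 {0}ᶜ (fun _ => c) := by
  refine ⟨|c|, abs_nonneg c, fun θ _ e => ⟨contDiffAt_const, fun i _ => ?_⟩⟩
  rw [iteratedDeriv_const]
  split_ifs with hi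
  · simp [hi]
  · rw [abs_zero]; positivity

/-! ### The periodic partition of unity and orthogonality of characters -/

/-- A smooth bump function on the line whose `2π`-translates form a partition of unity. -/
noncomputable def lineBump (t : ℝ) : ℝ :=
  Real.smoothTransition ((3 * Real.pi / 2 - t) / Real.pi) *
    Real.smoothTransition ((3 * Real.pi / 2 + t) / Real.pi)

lemma contDiff_lineBump : ContDiff ℝ (⊤ : ℕ∞) lineBump := by
  unfold lineBump
  exact (Real.smoothTransition.contDiff.comp (by fun_prop)).mul
    (Real.smoothTransition.contDiff.comp (by fun_prop))

lemma lineBump_nonneg (t : ℝ) : 0 ≤ lineBump t :=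
  mul_nonneg (Real.smoothTransition.nonneg _) (Real.smoothTransition.nonneg _)

lemma lineBump_le_one (t : ℝ) : lineBump t ≤ 1 :=
  mul_le_one₀ (Real.smoothTransition.le_one _) (Real.smoothTransition.nonneg _)
    (Real.smoothTransition.le_one _)

lemma lineBump_eq_zero {t : ℝ} (ht : 3 * Real.pi / 2 ≤ |t|) : lineBump t = 0 := by
  unfold lineBump
  rcases le_abs.1 ht with h | h
  · rw [Real.smoothTransition.zero_of_nonpos, zero_mul]
    exact div_nonpos_of_nonpos_of_nonneg (by linarith) Real.pi_pos.le
  · rw [mul_comm, Real.smoothTransition.zero_of_nonpos, zero_mul]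
    exact div_nonpos_of_nonpos_of_nonneg (by linarith) Real.pi_pos.le

lemma lineBump_of_nonneg {t : ℝ} (ht : -(Real.pi / 2) ≤ t) :
    lineBump t = Real.smoothTransition ((3 * Real.pi / 2 - t) / Real.pi) := by
  unfold lineBump
  rw [Real.smoothTransition.one_of_one_le (x := (3 * Real.pi / 2 + t) / Real.pi), mul_one]
  rw [le_div_iff₀ Real.pi_pos]; linarith

lemma lineBump_neg (t : ℝ) : lineBump (-t) = lineBump t := by
  unfold lineBump
  rw [mul_comm, sub_neg_eq_add, ← sub_eq_add_neg]

lemma lineBump_eq_one {t : ℝ} (ht : |t| ≤ Real.pi / 2) : lineBump t = 1 := by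
  rw [lineBump_of_nonneg (neg_le_of_abs_le ht)]
  refine Real.smoothTransition.one_of_one_le ?_
  rw [le_div_iff₀ Real.pi_pos]
  linarith [le_abs_self t]

lemma smoothTransition_add_one_sub (s : ℝ) :
    Real.smoothTransition s + Real.smoothTransition (1 - s) = 1 := by
  unfold Real.smoothTransition
  have h := Real.smoothTransition.pos_denom s
  rw [sub_sub_cancel, add_comm (expNegInvGlue (1 - s)), ← add_div, div_self h.ne']

/-- On `[0, 2π]` only these two translates matter; after reflecting the second, both are values of
`Real.smoothTransition` at arguments adding up to 1. -/
lemma lineBump_add_lineBump_sub {t : ℝ} (h0 : 0 ≤ t) (h2 : t ≤ 2 * Real.pi) :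
    lineBump t + lineBump (t - 2 * Real.pi) = 1 := by
  have hpi := Real.pi_pos
  rw [← lineBump_neg (t - _), lineBump_of_nonneg (by linarith), lineBump_of_nonneg (by linarith),
    ← smoothTransition_add_one_sub ((3 * Real.pi / 2 - t) / Real.pi)]
  congr 2
  field_simp
  ring

/-- Unfolding: the bump lives in `(-2π, 2π]`, and moving the negative half by one period recombines
the two weights to 1. -/
lemma integral_lineBump_mul {f : ℝ → ℝ} (hf : Continuous f)
    (hper : ∀ t, f (t - 2 * Real.pi) = f t) :
    ∫ t, lineBump t * f t = ∫ t in (0 : ℝ)..2 * Real.pi, f t := by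
  have hpi := Real.pi_pos
  have hcont : Continuous lineBump := contDiff_lineBump.continuous
  have hsupp : Function.support (fun t => lineBump t * f t) ⊆
      Set.Ioc (-(2 * Real.pi)) (2 * Real.pi) := by
    intro t ht
    have h1 : lineBump t ≠ 0 := left_ne_zero_of_mul ht
    have h2 : |t| < 3 * Real.pi / 2 := not_le.1 fun h => h1 (lineBump_eq_zero h)
    rw [abs_lt] at h2
    constructor <;> linarith
  have hint : ∀ a b, IntervalIntegrable (fun t => lineBump t * f t) volume a b := fun a b =>
    (hcont.mul hf).intervalIntegrable a b
  rw [← intervalIntegral.integral_eq_integral_of_support_subset hsupp,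
    ← intervalIntegral.integral_add_adjacent_intervals (hint _ 0) (hint 0 _)]
  have hshift : ∫ t in -(2 * Real.pi)..0, lineBump t * f t =
      ∫ t in (0 : ℝ)..2 * Real.pi, lineBump (t - 2 * Real.pi) * f t := by
    have := intervalIntegral.integral_comp_sub_right (a := 0) (b := 2 * Real.pi)
      (fun t => lineBump t * f t) (2 * Real.pi)
    simp only [hper, zero_sub, sub_self] at this
    exact this.symm
  have hint' : IntervalIntegrable (fun t => lineBump (t - 2 * Real.pi) * f t) volume 0
      (2 * Real.pi) := Continuous.intervalIntegrable (by fun_prop) _ _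
  rw [hshift, ← intervalIntegral.integral_add hint' (hint _ _)]
  refine intervalIntegral.integral_congr fun t ht => ?_
  rw [Set.uIcc_of_le (by positivity)] at ht
  rw [← add_mul, add_comm, lineBump_add_lineBump_sub ht.1 ht.2, one_mul]

lemma integral_lineBump_mul_cos (n : ℤ) :
    ∫ t, lineBump t * Real.cos (t * n) = if n = 0 then 2 * Real.pi else 0 := by
  rw [integral_lineBump_mul (by fun_prop) fun t => by
    rw [sub_mul, mul_comm (2 * Real.pi), Real.cos_sub_int_mul_two_pi]]
  split_ifs with h
  · simp [h]
  · have hn : (n : ℝ) ≠ 0 := by exact_mod_cast h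
    rw [intervalIntegral.integral_comp_mul_right (fun t => Real.cos t) hn, integral_cos]
    have : Real.sin (2 * Real.pi * n) = 0 := by
      have := Real.sin_int_mul_pi (2 * n)
      push_cast at this
      rw [← this]; ring_nf
    simp [this]

lemma integral_lineBump_mul_sin (n : ℤ) : ∫ t, lineBump t * Real.sin (t * n) = 0 := by
  rw [integral_lineBump_mul (by fun_prop) fun t => by
    rw [sub_mul, mul_comm (2 * Real.pi), Real.sin_sub_int_mul_two_pi]]
  by_cases h : n = 0
  · simp [h]
  · have hn : (n : ℝ) ≠ 0 := by exact_mod_cast h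
    rw [intervalIntegral.integral_comp_mul_right (fun t => Real.sin t) hn, integral_sin]
    have : Real.cos (2 * Real.pi * n) = 1 := by
      rw [mul_comm]; exact Real.cos_int_mul_two_pi n
    simp [this]

/-- The product bump function on the plane. -/
noncomputable def bump (θ : ℝ × ℝ) : ℝ := lineBump θ.1 * lineBump θ.2

lemma contDiff_bump : ContDiff ℝ (⊤ : ℕ∞) bump :=
  (contDiff_lineBump.comp contDiff_fst).mul (contDiff_lineBump.comp contDiff_snd)

lemma continuous_bump : Continuous bump := contDiff_bump.continuous

lemma bump_nonneg (θ : ℝ × ℝ) : 0 ≤ bump θ :=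
  mul_nonneg (lineBump_nonneg _) (lineBump_nonneg _)

lemma bump_le_one (θ : ℝ × ℝ) : bump θ ≤ 1 :=
  mul_le_one₀ (lineBump_le_one _) (lineBump_nonneg _) (lineBump_le_one _)

lemma bump_eq_zero {θ : ℝ × ℝ} (h : 3 * Real.pi / 2 ≤ ‖θ‖) : bump θ = 0 := by
  rw [Prod.norm_def, le_max_iff, Real.norm_eq_abs, Real.norm_eq_abs] at h
  unfold bump
  rcases h with h | h
  · rw [lineBump_eq_zero h, zero_mul]
  · rw [lineBump_eq_zero h, mul_zero]

lemma bump_eq_one {θ : ℝ × ℝ} (h : ‖θ‖ ≤ Real.pi / 2) : bump θ = 1 := by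
  rw [Prod.norm_def, max_le_iff, Real.norm_eq_abs, Real.norm_eq_abs] at h
  rw [bump, lineBump_eq_one h.1, lineBump_eq_one h.2, one_mul]

lemma hasCompactSupport_bump : HasCompactSupport bump :=
  HasCompactSupport.intro (isCompact_closedBall (0 : ℝ × ℝ) (3 * Real.pi / 2)) fun θ hθ => by
    rw [mem_closedBall_zero_iff, not_le] at hθ
    exact bump_eq_zero hθ.le

lemma integrable_bump : Integrable bump :=
  continuous_bump.integrable_of_hasCompactSupport hasCompactSupport_bump

/-- The Euclidean pairing of two vectors in the plane. -/
def dot (θ z : ℝ × ℝ) : ℝ := θ.1 * z.1 + θ.2 * z.2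

/-- The inclusion of the lattice in the plane. -/
def toPlane (z : ℤ × ℤ) : ℝ × ℝ := (z.1, z.2)

/-- Plays the role of orthogonality of characters on the torus. The addition formula factors the
integral into one-dimensional ones, and the sine factors vanish. -/
lemma integral_bump_mul_cos (z : ℤ × ℤ) :
    ∫ θ, bump θ * Real.cos (dot θ (toPlane z)) = if z = 0 then (2 * Real.pi) ^ 2 else 0 := by
  have hl : Integrable lineBump := by
    refine contDiff_lineBump.continuous.integrable_of_hasCompactSupport ?_
    refine HasCompactSupport.intro (isCompact_closedBall (0 : ℝ) (3 * Real.pi / 2)) fun t ht => ?_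
    rw [mem_closedBall_zero_iff, not_le] at ht
    exact lineBump_eq_zero ht.le
  have hcos : ∀ n : ℤ, Integrable fun t => lineBump t * Real.cos (t * n) := fun n =>
    hl.mul_bdd (c := 1) (by fun_prop) (Filter.Eventually.of_forall fun t => Real.abs_cos_le_one _)
  have hsin : ∀ n : ℤ, Integrable fun t => lineBump t * Real.sin (t * n) := fun n =>
    hl.mul_bdd (c := 1) (by fun_prop) (Filter.Eventually.of_forall fun t => Real.abs_sin_le_one _)
  have hexp : ∀ θ : ℝ × ℝ, bump θ * Real.cos (dot θ (toPlane z)) =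
      (lineBump θ.1 * Real.cos (θ.1 * z.1)) * (lineBump θ.2 * Real.cos (θ.2 * z.2)) -
      (lineBump θ.1 * Real.sin (θ.1 * z.1)) * (lineBump θ.2 * Real.sin (θ.2 * z.2)) := by
    intro θ
    simp only [bump, dot, toPlane, Real.cos_add]
    ring
  simp_rw [hexp]
  rw [Measure.volume_eq_prod, integral_sub ((hcos z.1).mul_prod (hcos z.2))
    ((hsin z.1).mul_prod (hsin z.2)),
    integral_prod_mul (fun t => lineBump t * Real.cos (t * z.1))
      (fun t => lineBump t * Real.cos (t * z.2)),
    integral_prod_mul (fun t => lineBump t * Real.sin (t * z.1))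
      (fun t => lineBump t * Real.sin (t * z.2)),
    integral_lineBump_mul_cos, integral_lineBump_mul_cos, integral_lineBump_mul_sin, zero_mul,
    sub_zero]
  rcases z with ⟨m, n⟩
  by_cases hm : m = 0 <;> by_cases hn : n = 0 <;> simp [hm, hn, sq]

/-- The function vanishes near the origin and its derivatives have compact support, so any
nonnegative order is allowed; only the function itself, which is bounded, has to be compared with
`‖θ‖ ^ σ` at infinity. -/
lemma isSymbol_one_sub_bump (k : ℕ) {σ : ℝ} (hσ : 0 ≤ σ) :
    IsSymbol k σ {0}ᶜ (fun θ => 1 - bump θ) := by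
  have hpi : 1 ≤ Real.pi / 2 := by linarith [Real.pi_gt_three]
  have hsmooth : ContDiff ℝ (⊤ : ℕ∞) (fun θ => 1 - bump θ) := contDiff_const.sub contDiff_bump
  have hbd : ∀ i : ℕ, ∃ B : ℝ, 0 ≤ B ∧ ∀ θ, ‖iteratedFDeriv ℝ i bump θ‖ ≤ B := by
    intro i
    obtain ⟨B, hB⟩ := (contDiff_bump.continuous_iteratedFDeriv (m := i)
      (by exact_mod_cast le_top)).bounded_above_of_compact_support
      (hasCompactSupport_bump.iteratedFDeriv i)
    exact ⟨B, (norm_nonneg _).trans (hB 0), hB⟩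
  choose B hB0 hB using hbd
  set R : ℝ := 3 * Real.pi / 2 with hR
  have hR1 : 1 ≤ R := by rw [hR]; linarith
  refine isSymbol_of_hasDerivAt
    (C := 1 + ∑ i ∈ Finset.range (k + 1), B i * R ^ |σ - i|)
    (by
      have : 0 ≤ ∑ i ∈ Finset.range (k + 1), B i * R ^ |σ - i| :=
        Finset.sum_nonneg fun i _ => mul_nonneg (hB0 i) (by positivity)
      linarith)
    (fun i e θ => iteratedFDeriv ℝ i (fun θ => 1 - bump θ) θ (fun _ => e)) ?_ ?_ ?_ ?_
  · intro e θ
    simp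
  · intro i _ e θ
    have h1 : HasFDerivAt (iteratedFDeriv ℝ i (fun θ => 1 - bump θ))
        (fderiv ℝ (iteratedFDeriv ℝ i (fun θ => 1 - bump θ)) (θ + (0 : ℝ) • e))
        (θ + (0 : ℝ) • e) :=
      (hsmooth.differentiable_iteratedFDeriv (by exact_mod_cast WithTop.coe_lt_top _) _).hasFDerivAt
    have h2 : HasDerivAt (fun t : ℝ => θ + t • e) e 0 := by
      simpa using ((hasDerivAt_id (0 : ℝ)).smul_const e).const_add θ
    have h3 := h1.comp_hasDerivAt (0 : ℝ) h2
    have h4 := ((ContinuousMultilinearMap.apply ℝ (fun _ : Fin i => ℝ × ℝ) ℝ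
      (fun _ => e)).hasFDerivAt).comp_hasDerivAt (0 : ℝ) h3
    simp only [zero_smul, add_zero] at h4
    rw [iteratedFDeriv_succ_apply_left]
    exact h4
  · intro e θ
    exact (ContinuousMultilinearMap.apply ℝ (fun _ : Fin k => ℝ × ℝ) ℝ
      (fun _ => e)).continuous.comp ((hsmooth.continuous_iteratedFDeriv (m := k)
        (by exact_mod_cast le_top)).comp (by fun_prop))
  · intro i hi e θ hθ
    have hS : ∀ j ∈ Finset.range (k + 1), 0 ≤ B j * R ^ |σ - j| := fun j _ =>
      mul_nonneg (hB0 j) (by positivity)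
    have hterm : B i * R ^ |σ - i| ≤ ∑ i ∈ Finset.range (k + 1), B i * R ^ |σ - i| :=
      Finset.single_le_sum hS (Finset.mem_range.2 (by omega))
    -- Three zones: zero inside radius π/2, bounded derivatives up to radius `R`, constant beyond.
    -- Since π/2 > 1, powers of `‖θ‖` are monotone in the exponent outside the first zone.
    rcases lt_or_ge ‖θ‖ (Real.pi / 2) with hsmall | hlarge
    · have hev : (fun θ => 1 - bump θ) =ᶠ[nhds θ] fun _ => (0 : ℝ) := by
        have : {η : ℝ × ℝ | ‖η‖ < Real.pi / 2} ∈ nhds θ :=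
          (isOpen_lt continuous_norm continuous_const).mem_nhds hsmall
        filter_upwards [this] with η hη
        rw [bump_eq_one (le_of_lt hη), sub_self]
      rw [(hev.iteratedFDeriv ℝ i).eq_of_nhds]
      simp only [iteratedFDeriv_fun_zero, Pi.zero_apply, zero_apply,
        abs_zero]
      have := Finset.sum_nonneg hS
      positivity
    · have hpos : 0 < ‖θ‖ := by linarith
      rcases Nat.eq_zero_or_pos i with rfl | hi0
      · simp only [iteratedFDeriv_zero_apply, pow_zero, mul_one, Nat.cast_zero, sub_zero]
        have h1 : |1 - bump θ| ≤ 1 := by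
          rw [abs_le]; constructor <;> linarith [bump_nonneg θ, bump_le_one θ]
        have h2 : (1 : ℝ) ≤ ‖θ‖ ^ σ := Real.one_le_rpow (hpi.trans hlarge) hσ
        have h3 := Finset.sum_nonneg hS
        nlinarith
      · have heq : iteratedFDeriv ℝ i (fun θ => 1 - bump θ) θ = -iteratedFDeriv ℝ i bump θ := by
          rw [fun_iteratedFDeriv_sub_apply contDiffAt_const (contDiff_bump.of_le
            (by exact_mod_cast le_top)).contDiffAt, iteratedFDeriv_const_of_ne hi0.ne']
          simp
        rw [heq]
        rcases le_or_gt ‖θ‖ R with hmid | hbig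
        · have h1 : |(-iteratedFDeriv ℝ i bump θ) (fun _ => e)| ≤ B i * ‖e‖ ^ i := by
            have := (-iteratedFDeriv ℝ i bump θ).le_opNorm (fun _ => e)
            rw [norm_neg, Finset.prod_const, Finset.card_univ, Fintype.card_fin,
              Real.norm_eq_abs] at this
            exact this.trans (by gcongr; exact hB i θ)
          have h2 : 1 ≤ R ^ |σ - i| * ‖θ‖ ^ (σ - i) := by
            have h3 : ‖θ‖ ^ (-(σ - i)) ≤ R ^ |σ - i| :=
              (Real.rpow_le_rpow_of_exponent_le (hpi.trans hlarge) (neg_le_abs _)).trans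
                (Real.rpow_le_rpow hpos.le hmid (abs_nonneg _))
            calc (1 : ℝ) = ‖θ‖ ^ (-(σ - i)) * ‖θ‖ ^ (σ - i) := by
                  rw [← Real.rpow_add hpos]; simp
              _ ≤ _ := by gcongr
          calc _ ≤ B i * ‖e‖ ^ i * 1 := by rw [mul_one]; exact h1
            _ ≤ B i * ‖e‖ ^ i * (R ^ |σ - i| * ‖θ‖ ^ (σ - i)) := by
                have := hB0 i
                gcongr
            _ = (B i * R ^ |σ - i|) * ‖e‖ ^ i * ‖θ‖ ^ (σ - i) := by ring
            _ ≤ _ := by gcongr; linarith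
        · have hev : bump =ᶠ[nhds θ] fun _ => (0 : ℝ) := by
            have : {η : ℝ × ℝ | R < ‖η‖} ∈ nhds θ :=
              (isOpen_lt continuous_const continuous_norm).mem_nhds hbig
            filter_upwards [this] with η hη using bump_eq_zero (le_of_lt hη)
          rw [(hev.iteratedFDeriv ℝ i).eq_of_nhds]
          simp only [iteratedFDeriv_fun_zero, Pi.zero_apply, neg_zero,
            zero_apply, abs_zero]
          have := Finset.sum_nonneg hS
          positivity

lemma isSymbol_bump (k : ℕ) : IsSymbol k 0 {0}ᶜ bump := by
  simpa using (isSymbol_const k 1).sub (isSymbol_one_sub_bump k le_rfl)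

/-! ### The second-order Taylor remainder of the characteristic function -/

/-- The regularities `k` and the orders `σ` of the error term that are used for the walk. -/
def Admissible (k : ℕ) (σ : ℝ) : Prop := (k = 1 ∧ 0 < σ ∧ σ < 1) ∨ (k = 3 ∧ σ = 2)

namespace Admissible

variable {k : ℕ} {σ : ℝ}

lemma pos (h : Admissible k σ) : 0 < σ := by
  rcases h with ⟨-, h, -⟩ | ⟨-, rfl⟩
  · exact h
  · norm_num

lemma le_two (h : Admissible k σ) : σ ≤ 2 := by
  rcases h with ⟨-, -, h⟩ | ⟨-, rfl⟩
  · linarith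
  · norm_num

/-- Needed for convergence at infinity of the integral of `‖θ‖ ^ (σ - 2 - k)` in the Fourier decay
estimate. -/
lemma lt_natCast (h : Admissible k σ) : σ < k := by
  rcases h with ⟨rfl, -, h⟩ | ⟨rfl, rfl⟩
  · exact_mod_cast h
  · norm_num

/-- Keeps the exponent `2 + σ - i` nonnegative, so that `i` derivatives cost no more than the moment
of order `2 + σ`. -/
lemma natCast_le (h : Admissible k σ) : (k : ℝ) ≤ 2 + σ := by
  rcases h with ⟨rfl, h, -⟩ | ⟨rfl, rfl⟩
  · push_cast; linarith
  · norm_num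

end Admissible

/-- The remainder `1 - cos s - s² / 2` and its derivatives up to the third. -/
noncomputable def cosRem : ℕ → ℝ → ℝ
  | 0, s => 1 - Real.cos s - s ^ 2 / 2
  | 1, s => Real.sin s - s
  | 2, s => Real.cos s - 1
  | _, s => -Real.sin s

lemma hasDerivAt_cosRem {i : ℕ} (hi : i < 3) (s : ℝ) :
    HasDerivAt (cosRem i) (cosRem (i + 1) s) s := by
  interval_cases i
  · have h := ((hasDerivAt_const s (1 : ℝ)).sub (Real.hasDerivAt_cos s)).sub
      (((hasDerivAt_id s).pow 2).div_const 2)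
    refine h.congr_deriv ?_
    simp [cosRem]
  · exact (Real.hasDerivAt_sin s).sub (hasDerivAt_id s)
  · exact (Real.hasDerivAt_cos s).sub_const 1

@[fun_prop]
lemma continuous_cosRem (i : ℕ) : Continuous (cosRem i) := by
  rcases i with _ | _ | _ | i
  · show Continuous fun s : ℝ => 1 - Real.cos s - s ^ 2 / 2
    fun_prop
  · show Continuous fun s : ℝ => Real.sin s - s
    fun_prop
  · show Continuous fun s : ℝ => Real.cos s - 1
    fun_prop
  · show Continuous fun s : ℝ => -Real.sin s
    fun_prop

/-- Interpolation between two powers: use the larger one for `x ≤ 1` and the smaller one for `x ≥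
1`. -/
lemma le_mul_rpow_of_le_of_le {x A C a b p : ℝ} (hx : 0 ≤ x) (hC : 0 ≤ C) (ha : 0 < a)
    (hap : a ≤ p) (hpb : p ≤ b) (h1 : A ≤ C * x ^ a) (h2 : A ≤ C * x ^ b) : A ≤ C * x ^ p := by
  rcases hx.eq_or_lt with rfl | hx
  · rw [Real.zero_rpow ha.ne'] at h1
    rwa [Real.zero_rpow (by linarith)]
  rcases le_total x 1 with h | h
  · exact h2.trans (mul_le_mul_of_nonneg_left (Real.rpow_le_rpow_of_exponent_ge hx h hpb) hC)
  · exact h1.trans (mul_le_mul_of_nonneg_left (Real.rpow_le_rpow_of_exponent_le h hap) hC)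

lemma abs_cosRem_zero_le (s : ℝ) : |cosRem 0 s| ≤ |s| ^ 2 ∧ |cosRem 0 s| ≤ |s| ^ 4 := by
  have h1 : |cosRem 0 s| ≤ |s| ^ 2 := by
    simp only [cosRem, sq_abs]
    rw [abs_le]
    constructor
    · linarith [Real.cos_le_one s, sq_nonneg s]
    · linarith [Real.one_sub_sq_div_two_le_cos (x := s), sq_nonneg s]
  refine ⟨h1, ?_⟩
  rcases le_or_gt |s| 1 with h | h
  · have := Real.cos_bound h
    simp only [cosRem]
    rw [← abs_neg, show -(1 - Real.cos s - s ^ 2 / 2) = Real.cos s - (1 - s ^ 2 / 2) by ring]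
    refine this.trans ?_
    have : 0 ≤ |s| ^ 4 := by positivity
    linarith
  · exact h1.trans (pow_le_pow_right₀ h.le (by norm_num))

lemma abs_cosRem_one_le (s : ℝ) : |cosRem 1 s| ≤ 2 * |s| ∧ |cosRem 1 s| ≤ 2 * |s| ^ 3 := by
  have h1 : |cosRem 1 s| ≤ 2 * |s| := by
    simp only [cosRem]
    calc |Real.sin s - s| ≤ |Real.sin s| + |s| := abs_sub _ _
      _ ≤ _ := by linarith [Real.abs_sin_le_abs (x := s)]
  refine ⟨h1, ?_⟩
  rcases le_or_gt |s| 1 with h | h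
  · have h2 := Real.sin_bound h
    have h4 : |s| ^ 5 ≤ |s| ^ 3 := pow_le_pow_of_le_one (abs_nonneg s) h (by norm_num)
    simp only [cosRem]
    calc |Real.sin s - s| = |(Real.sin s - (s - s ^ 3 / 6)) - s ^ 3 / 6| := by congr 1; ring
      _ ≤ |Real.sin s - (s - s ^ 3 / 6)| + |s ^ 3 / 6| := abs_sub _ _
      _ ≤ |s| ^ 5 / 100 + |s| ^ 3 / 6 := by
          refine add_le_add h2 ?_
          rw [abs_div, abs_pow]; norm_num
      _ ≤ _ := by
          have : 0 ≤ |s| ^ 3 := by positivity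
          linarith
  · refine h1.trans ?_
    have := le_self_pow₀ h.le (by norm_num : (3 : ℕ) ≠ 0)
    linarith

/-- Orders 0 and 1 interpolate between the trivial bound and the Taylor bound. Orders 2 and 3 occur
only for `σ = 2`, where the exponents are exactly 2 and 1. -/
lemma abs_cosRem_le {k : ℕ} {σ : ℝ} (hk : Admissible k σ) {i : ℕ} (hi : i ≤ k) (s : ℝ) :
    |cosRem i s| ≤ 2 * |s| ^ (2 + σ - i) := by
  have hσ0 := hk.pos
  have hσ2 := hk.le_two
  have hs := abs_nonneg s
  rcases i with _ | _ | i
  · obtain ⟨h1, h2⟩ := abs_cosRem_zero_le s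
    refine le_mul_rpow_of_le_of_le (a := 2) (b := 4) hs (by norm_num) (by norm_num)
      (by push_cast; linarith) (by push_cast; linarith) ?_ ?_
    · have : |s| ^ (2 : ℝ) = |s| ^ 2 := by exact_mod_cast Real.rpow_natCast |s| 2
      rw [this]; nlinarith [sq_nonneg |s|]
    · have : |s| ^ (4 : ℝ) = |s| ^ 4 := by exact_mod_cast Real.rpow_natCast |s| 4
      rw [this]; have : 0 ≤ |s| ^ 4 := by positivity
      linarith
  · obtain ⟨h1, h2⟩ := abs_cosRem_one_le s
    refine le_mul_rpow_of_le_of_le (a := 1) (b := 3) hs (by norm_num) (by norm_num)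
      (by push_cast; linarith) (by push_cast; linarith) ?_ ?_
    · rw [Real.rpow_one]; exact h1
    · have : |s| ^ (3 : ℝ) = |s| ^ 3 := by exact_mod_cast Real.rpow_natCast |s| 3
      rw [this]; exact h2
  · rcases hk with ⟨rfl, -, -⟩ | ⟨rfl, rfl⟩
    · omega
    rcases i with _ | _ | i
    · have h1 := Real.one_sub_sq_div_two_le_cos (x := s)
      have h2 := Real.cos_le_one s
      have h3 : |s| ^ ((2 : ℝ) + 2 - (0 + 1 + 1 : ℕ)) = s ^ 2 := by
        rw [← sq_abs, ← Real.rpow_natCast]; norm_num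
      rw [h3]
      simp only [cosRem]
      rw [abs_le]
      constructor <;> linarith [sq_nonneg s]
    · have h3 : |s| ^ ((2 : ℝ) + 2 - (0 + 1 + 1 + 1 : ℕ)) = |s| := by
        norm_num
      rw [h3]
      simp only [cosRem, abs_neg]
      linarith [Real.abs_sin_le_abs (x := s)]
    · omega

lemma abs_dot_le (a b : ℝ × ℝ) : |dot a b| ≤ 2 * ‖a‖ * ‖b‖ := by
  have ha1 := norm_fst_le a
  have ha2 := norm_snd_le a
  have hb1 := norm_fst_le b
  have hb2 := norm_snd_le b
  simp only [Real.norm_eq_abs] at ha1 ha2 hb1 hb2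
  calc |dot a b| ≤ |a.1 * b.1| + |a.2 * b.2| := abs_add_le _ _
    _ = |a.1| * |b.1| + |a.2| * |b.2| := by rw [abs_mul, abs_mul]
    _ ≤ ‖a‖ * ‖b‖ + ‖a‖ * ‖b‖ := by gcongr
    _ = _ := by ring

lemma dot_add_left (a b z : ℝ × ℝ) : dot (a + b) z = dot a z + dot b z := by
  simp [dot]; ring

lemma dot_smul_left (c : ℝ) (a z : ℝ × ℝ) : dot (c • a) z = c * dot a z := by
  simp [dot]; ring

/-- Whatever `i` is, the powers of `‖z‖` combine to exactly `2 + σ`, so one moment dominates all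
derivatives under the expectation. -/
lemma abs_dot_pow_mul_cosRem_le {k : ℕ} {σ : ℝ} (hk : Admissible k σ) {i : ℕ} (hi : i ≤ k)
    (e θ z : ℝ × ℝ) : |dot e z ^ i * cosRem i (dot θ z)| ≤
      (2 * 2 ^ (2 + σ) * ‖z‖ ^ (2 + σ)) * ‖e‖ ^ i * ‖θ‖ ^ (2 + σ - i) := by
  have hik : (i : ℝ) ≤ 2 + σ := le_trans (by exact_mod_cast hi) hk.natCast_le
  have hσ0 := hk.pos
  have hsplit : ∀ x : ℝ, 0 ≤ x → x ^ i * x ^ (2 + σ - i) = x ^ (2 + σ) := by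
    intro x hx
    rw [← Real.rpow_natCast, ← Real.rpow_add_of_nonneg hx (Nat.cast_nonneg _) (by linarith)]
    congr 1; ring
  rw [abs_mul, abs_pow]
  calc |dot e z| ^ i * |cosRem i (dot θ z)|
      ≤ (2 * ‖e‖ * ‖z‖) ^ i * (2 * (2 * ‖θ‖ * ‖z‖) ^ (2 + σ - i)) := by
        gcongr
        · exact abs_dot_le e z
        · refine (abs_cosRem_le hk hi _).trans ?_
          gcongr
          exact abs_dot_le θ z
    _ = 2 * (2 ^ i * 2 ^ (2 + σ - i)) * (‖z‖ ^ i * ‖z‖ ^ (2 + σ - i)) * ‖e‖ ^ i *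
          ‖θ‖ ^ (2 + σ - i) := by
        rw [Real.mul_rpow (by positivity) (norm_nonneg _),
          Real.mul_rpow (by norm_num) (norm_nonneg _)]
        ring
    _ = _ := by rw [hsplit 2 (by norm_num), hsplit _ (norm_nonneg _)]

/-- The Taylor remainder of second order of a characteristic function is a symbol of order
`2 + σ` if there are moments of that order. -/
lemma isSymbol_integral_cosRem {Ω : Type*} [MeasurableSpace Ω] {P : Measure Ω} {Z : Ω → ℝ × ℝ}
    (hZ : Measurable Z) {k : ℕ} {σ : ℝ} (hk : Admissible k σ)
    (hmom : Integrable (fun ω => ‖Z ω‖ ^ (2 + σ)) P) :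
    IsSymbol k (2 + σ) {0}ᶜ (fun θ => ∫ ω, cosRem 0 (dot θ (Z ω)) ∂P) := by
  have hk3 : k ≤ 3 := by rcases hk with ⟨rfl, -⟩ | ⟨rfl, -⟩ <;> norm_num
  have hmeas : ∀ (i : ℕ) (e θ : ℝ × ℝ),
      AEStronglyMeasurable (fun ω => dot e (Z ω) ^ i * cosRem i (dot θ (Z ω))) P := by
    intro i e θ
    have hc : Continuous fun z : ℝ × ℝ => dot e z ^ i * cosRem i (dot θ z) := by
      have h1 : Continuous fun z : ℝ × ℝ => dot e z := by unfold dot; fun_prop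
      have h2 : Continuous fun z : ℝ × ℝ => dot θ z := by unfold dot; fun_prop
      exact (h1.pow i).mul ((continuous_cosRem i).comp h2)
    exact (hc.measurable.comp hZ).aestronglyMeasurable
  have hint : ∀ i ≤ k, ∀ e θ : ℝ × ℝ,
      Integrable (fun ω => dot e (Z ω) ^ i * cosRem i (dot θ (Z ω))) P := by
    intro i hi e θ
    refine Integrable.mono' (((hmom.const_mul (2 * 2 ^ (2 + σ))).mul_const (‖e‖ ^ i)).mul_const
      (‖θ‖ ^ (2 + σ - i))) (hmeas i e θ) (Filter.Eventually.of_forall fun ω => ?_)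
    exact abs_dot_pow_mul_cosRem_le hk hi e θ (Z ω)
  -- A dominating function uniform over a unit interval of parameters, used both for differentiation
  -- and for continuity under the integral.
  have hlocal : ∀ i ≤ k, ∀ e θ : ℝ × ℝ, ∀ t₀ : ℝ, ∀ ω, ∀ t ∈ Metric.ball t₀ 1,
      ‖dot e (Z ω) ^ i * cosRem i (dot (θ + t • e) (Z ω))‖ ≤
        (2 * 2 ^ (2 + σ) * ‖Z ω‖ ^ (2 + σ)) * ‖e‖ ^ i *
          (‖θ‖ + (|t₀| + 1) * ‖e‖) ^ (2 + σ - i) := by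
    intro i hi e θ t₀ ω t ht
    refine (abs_dot_pow_mul_cosRem_le hk hi e (θ + t • e) (Z ω)).trans ?_
    have hik : (i : ℝ) ≤ 2 + σ := le_trans (by exact_mod_cast hi) hk.natCast_le
    have hn : ‖θ + t • e‖ ≤ ‖θ‖ + (|t₀| + 1) * ‖e‖ := by
      refine (norm_add_le _ _).trans ?_
      rw [norm_smul, Real.norm_eq_abs]
      gcongr
      rw [Metric.mem_ball, Real.dist_eq] at ht
      have := abs_sub_abs_le_abs_sub t t₀
      linarith
    gcongr
  have hboundint : ∀ (i : ℕ) (e θ : ℝ × ℝ) (t₀ : ℝ), Integrable (fun ω =>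
      (2 * 2 ^ (2 + σ) * ‖Z ω‖ ^ (2 + σ)) * ‖e‖ ^ i *
          (‖θ‖ + (|t₀| + 1) * ‖e‖) ^ (2 + σ - i)) P := fun i e θ t₀ =>
    ((hmom.const_mul (2 * 2 ^ (2 + σ))).mul_const _).mul_const _
  refine isSymbol_of_hasDerivAt (C := ∫ ω, 2 * 2 ^ (2 + σ) * ‖Z ω‖ ^ (2 + σ) ∂P)
    (integral_nonneg fun ω => by positivity)
    (fun i e θ => ∫ ω, dot e (Z ω) ^ i * cosRem i (dot θ (Z ω)) ∂P) ?_ ?_ ?_ ?_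
  · intro e θ
    simp
  · intro i hi e θ
    have h := hasDerivAt_integral_of_dominated_loc_of_deriv_le (μ := P)
      (F := fun t ω => dot e (Z ω) ^ i * cosRem i (dot (θ + t • e) (Z ω)))
      (F' := fun t ω => dot e (Z ω) ^ (i + 1) * cosRem (i + 1) (dot (θ + t • e) (Z ω)))
      (x₀ := (0 : ℝ)) (s := Metric.ball 0 1) (Metric.ball_mem_nhds _ one_pos)
      (Filter.Eventually.of_forall fun t => hmeas i e _) (hint i hi.le e _)
      (hmeas (i + 1) e _)
      (Filter.Eventually.of_forall fun ω => hlocal (i + 1) hi e θ 0 ω) (hboundint _ _ _ _)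
      (Filter.Eventually.of_forall fun ω t _ => ?_)
    · simpa using h.2
    · have h1 : HasDerivAt (fun t : ℝ => dot (θ + t • e) (Z ω)) (dot e (Z ω)) t := by
        simp only [dot_add_left, dot_smul_left]
        simpa using ((hasDerivAt_id t).mul_const (dot e (Z ω))).const_add (dot θ (Z ω))
      have h2 := ((hasDerivAt_cosRem (by omega : i < 3) _).comp t h1).const_mul (dot e (Z ω) ^ i)
      exact h2.congr_deriv (by ring)
  · intro e θ
    refine continuous_iff_continuousAt.2 fun t₀ => continuousAt_of_dominated
      (bound := fun ω => (2 * 2 ^ (2 + σ) * ‖Z ω‖ ^ (2 + σ)) * ‖e‖ ^ k *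
          (‖θ‖ + (|t₀| + 1) * ‖e‖) ^ (2 + σ - k))
      (Filter.Eventually.of_forall fun t => hmeas k e _) ?_ (hboundint _ _ _ _) ?_
    · filter_upwards [Metric.ball_mem_nhds t₀ one_pos] with t ht
      exact Filter.Eventually.of_forall fun ω => hlocal k le_rfl e θ t₀ ω t ht
    · refine Filter.Eventually.of_forall fun ω => Continuous.continuousAt ?_
      have : Continuous fun t : ℝ => dot (θ + t • e) (Z ω) := by unfold dot; fun_prop
      exact continuous_const.mul ((continuous_cosRem k).comp this)
  · intro i hi e θ _
    rw [← integral_mul_const, ← integral_mul_const]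
    rw [← Real.norm_eq_abs]
    exact norm_integral_le_of_norm_le
      (((hmom.const_mul (2 * 2 ^ (2 + σ))).mul_const _).mul_const _)
      (Filter.Eventually.of_forall fun ω => abs_dot_pow_mul_cosRem_le hk hi e θ (Z ω))

/-! ### The quadratic form and the Gaussian as symbols -/

/-- Half the square of the Euclidean norm. -/
noncomputable def quad (θ : ℝ × ℝ) : ℝ := (θ.1 ^ 2 + θ.2 ^ 2) / 2

@[fun_prop]
lemma continuous_quad : Continuous quad := by unfold quad; fun_prop

lemma quad_le (θ : ℝ × ℝ) : quad θ ≤ ‖θ‖ ^ 2 := by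
  have h1 := norm_fst_le θ
  have h2 := norm_snd_le θ
  rw [Real.norm_eq_abs] at h1 h2
  have h3 := sq_le_sq' (neg_le_of_abs_le h1) (le_of_abs_le h1)
  have h4 := sq_le_sq' (neg_le_of_abs_le h2) (le_of_abs_le h2)
  unfold quad; linarith

lemma sq_norm_le_quad (θ : ℝ × ℝ) : ‖θ‖ ^ 2 / 2 ≤ quad θ := by
  unfold quad
  rw [Prod.norm_def, Real.norm_eq_abs, Real.norm_eq_abs]
  rcases max_choice |θ.1| |θ.2| with h | h <;> rw [h, sq_abs] <;>
    linarith [sq_nonneg θ.1, sq_nonneg θ.2]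

lemma quad_nonneg (θ : ℝ × ℝ) : 0 ≤ quad θ := by unfold quad; positivity

lemma quad_pos {θ : ℝ × ℝ} (h : θ ≠ 0) : 0 < quad θ := by
  have := norm_pos_iff.2 h
  exact lt_of_lt_of_le (by positivity) (sq_norm_le_quad θ)

lemma hasDerivAt_quad (θ e : ℝ × ℝ) :
    HasDerivAt (fun t : ℝ => quad (θ + t • e)) (dot θ e) 0 := by
  have h : (fun t : ℝ => quad (θ + t • e)) = fun t => quad θ + t * dot θ e + t ^ 2 * quad e := by
    funext t; simp [quad, dot]; ring
  rw [h]
  have h1 := (((hasDerivAt_id (0 : ℝ)).mul_const (dot θ e)).const_add (quad θ)).add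
    (((hasDerivAt_id (0 : ℝ)).pow 2).mul_const (quad e))
  exact h1.congr_deriv (by simp)

lemma hasDerivAt_dot (θ e z : ℝ × ℝ) :
    HasDerivAt (fun t : ℝ => dot (θ + t • e) z) (dot e z) 0 := by
  simp only [dot_add_left, dot_smul_left]
  simpa using ((hasDerivAt_id (0 : ℝ)).mul_const (dot e z)).const_add (dot θ z)

lemma isSymbol_quad (k : ℕ) : IsSymbol k 2 {0}ᶜ quad := by
  refine isSymbol_of_hasDerivAt (C := 2) (by norm_num)
    (fun i e θ => match i with
      | 0 => quad θ
      | 1 => dot θ e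
      | 2 => dot e e
      | _ => 0) (fun _ _ => rfl) ?_ ?_ ?_
  · rintro (_ | _ | _ | i) _ e θ
    · exact hasDerivAt_quad θ e
    · exact hasDerivAt_dot θ e e
    · exact hasDerivAt_const _ _
    · exact hasDerivAt_const _ _
  · intro e θ
    rcases k with _ | _ | _ | k <;> simp only [dot] <;> fun_prop
  · rintro (_ | _ | _ | i) _ e θ hθ
    · have h := quad_le θ
      have h2 : ‖θ‖ ^ ((2 : ℝ) - (0 : ℕ)) = ‖θ‖ ^ 2 := by
        rw [← Real.rpow_natCast]; norm_num
      rw [h2]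
      simp only [abs_of_nonneg (quad_nonneg θ), pow_zero, mul_one]
      linarith [sq_nonneg ‖θ‖]
    · have h2 : ‖θ‖ ^ ((2 : ℝ) - (0 + 1 : ℕ)) = ‖θ‖ := by norm_num
      rw [h2]
      refine (abs_dot_le θ e).trans (le_of_eq ?_)
      ring
    · have h2 : ‖θ‖ ^ ((2 : ℝ) - (0 + 1 + 1 : ℕ)) = 1 := by norm_num
      rw [h2]
      refine (abs_dot_le e e).trans (le_of_eq ?_)
      ring
    · simp only [abs_zero]; positivity

lemma isSymbol_inv_quad (k : ℕ) : IsSymbol k (-2) {0}ᶜ (fun θ => (quad θ)⁻¹) := by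
  refine (isSymbol_quad k).inv (fun θ h => h) (c := 1 / 2) (by norm_num) fun θ _ => ?_
  have := sq_norm_le_quad θ
  rw [abs_of_nonneg (quad_nonneg θ)]
  have h2 : ‖θ‖ ^ (2 : ℝ) = ‖θ‖ ^ 2 := by exact_mod_cast Real.rpow_natCast ‖θ‖ 2
  rw [h2]; linarith

/-- The standard Gaussian density without its normalization. -/
noncomputable def gauss (θ : ℝ × ℝ) : ℝ := Real.exp (-quad θ)

@[fun_prop]
lemma continuous_gauss : Continuous gauss := by unfold gauss; fun_prop

lemma gauss_pos (θ : ℝ × ℝ) : 0 < gauss θ := Real.exp_pos _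

lemma gauss_le_one (θ : ℝ × ℝ) : gauss θ ≤ 1 := Real.exp_le_one_iff.2 (by linarith [quad_nonneg θ])

/-- A single term of the exponential series is at most the exponential; apply this to `‖θ‖ ^ 2 / 2 ≤
quad θ`. -/
lemma norm_pow_mul_gauss_le (n : ℕ) (θ : ℝ × ℝ) :
    ‖θ‖ ^ (2 * n) * gauss θ ≤ 2 ^ n * n.factorial := by
  have h1 : (‖θ‖ ^ 2 / 2) ^ n / n.factorial ≤ Real.exp (‖θ‖ ^ 2 / 2) :=
    Real.pow_div_factorial_le_exp _ (by positivity) n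
  have h2 : gauss θ ≤ Real.exp (-(‖θ‖ ^ 2 / 2)) :=
    Real.exp_le_exp.2 (neg_le_neg (sq_norm_le_quad θ))
  rw [div_le_iff₀ (by positivity), div_pow, ← pow_mul, div_le_iff₀ (by positivity)] at h1
  calc ‖θ‖ ^ (2 * n) * gauss θ
      ≤ (Real.exp (‖θ‖ ^ 2 / 2) * n.factorial * 2 ^ n) * Real.exp (-(‖θ‖ ^ 2 / 2)) :=
        mul_le_mul h1 h2 (gauss_pos θ).le (by positivity)
    _ = (Real.exp (‖θ‖ ^ 2 / 2) * Real.exp (-(‖θ‖ ^ 2 / 2))) * (2 ^ n * n.factorial) := by ring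
    _ = _ := by rw [← Real.exp_add]; simp

lemma hasDerivAt_gauss (θ e : ℝ × ℝ) :
    HasDerivAt (fun t : ℝ => gauss (θ + t • e)) (-(dot θ e * gauss θ)) 0 := by
  have h := (hasDerivAt_quad θ e).neg.exp
  refine h.congr_deriv ?_
  simp [gauss]; ring

/-- The directional derivatives of `1 - gauss` up to the third. -/
noncomputable def gaussJet : ℕ → ℝ × ℝ → ℝ × ℝ → ℝ
  | 0, _, θ => 1 - gauss θ
  | 1, e, θ => dot θ e * gauss θ
  | 2, e, θ => (dot e e - dot θ e ^ 2) * gauss θ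
  | _, e, θ => (dot θ e ^ 3 - 3 * dot θ e * dot e e) * gauss θ

lemma hasDerivAt_gaussJet {i : ℕ} (hi : i < 3) (e θ : ℝ × ℝ) :
    HasDerivAt (fun t : ℝ => gaussJet i e (θ + t • e)) (gaussJet (i + 1) e θ) 0 := by
  have hg := hasDerivAt_gauss θ e
  have hd := hasDerivAt_dot θ e e
  interval_cases i
  · exact (hg.const_sub 1).congr_deriv (by simp [gaussJet])
  · refine (hd.mul hg).congr_deriv ?_
    simp [gaussJet]; ring
  · refine (((hd.pow 2).const_sub (dot e e)).mul hg).congr_deriv ?_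
    simp [gaussJet]; ring

/-- One bound is for large `θ`, the other for small `θ`. The constant 500 covers the worst case: at
third order the estimate is 8·48 + 12·8 = 480. -/
lemma norm_pow_mul_abs_gaussJet_le {i : ℕ} (hi : i ≤ 3) (e θ : ℝ × ℝ) :
    ‖θ‖ ^ i * |gaussJet i e θ| ≤ 500 * ‖e‖ ^ i * 1 ∧
    ‖θ‖ ^ i * |gaussJet i e θ| ≤ 500 * ‖e‖ ^ i * ‖θ‖ ^ 2 := by
  set r := ‖θ‖ with hr
  set s := ‖e‖ with hs
  have hr0 : 0 ≤ r := norm_nonneg _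
  have hs0 : 0 ≤ s := norm_nonneg _
  have hG0 := (gauss_pos θ).le
  have h0 := gauss_le_one θ
  have h1 := norm_pow_mul_gauss_le 1 θ
  have h2 := norm_pow_mul_gauss_le 2 θ
  have h3 := norm_pow_mul_gauss_le 3 θ
  norm_num [Nat.factorial] at h1 h2 h3
  rw [← hr] at h1 h2 h3
  have hb := abs_dot_le θ e
  have hc := abs_dot_le e e
  rw [← hr, ← hs] at hb
  rw [← hs] at hc
  have key : ∀ m : ℝ, 0 ≤ m → ∀ A B : ℝ, A ≤ 500 → B ≤ 500 → ∀ Q : ℝ,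
      Q ≤ m * A → Q ≤ m * (r ^ 2 * B) → Q ≤ 500 * m * 1 ∧ Q ≤ 500 * m * r ^ 2 := by
    intro m hm A B hA hB Q h h'
    constructor
    · nlinarith [mul_le_mul_of_nonneg_left hA hm]
    · have : m * (r ^ 2 * B) ≤ m * (r ^ 2 * 500) := by gcongr
      linarith
  interval_cases i
  · have hq : 1 - gauss θ ≤ r ^ 2 := by
      have := Real.add_one_le_exp (-quad θ)
      have := quad_le θ
      unfold gauss; linarith
    simp only [gaussJet, pow_zero, one_mul, mul_one, abs_of_nonneg (sub_nonneg.2 h0)]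
    constructor
    · linarith
    · nlinarith [sq_nonneg r]
  · have hQ : r ^ 1 * |gaussJet 1 e θ| ≤ s ^ 1 * (2 * (r ^ 2 * gauss θ)) := by
      simp only [gaussJet, abs_mul, abs_of_nonneg hG0]
      calc r ^ 1 * (|dot θ e| * gauss θ) ≤ r ^ 1 * ((2 * r * s) * gauss θ) := by gcongr
        _ = _ := by ring
    refine key (s ^ 1) (by positivity) _ (2 * gauss θ) ?_ (by linarith) _ hQ
      (hQ.trans (by rw [show r ^ 2 * (2 * gauss θ) = 2 * (r ^ 2 * gauss θ) by ring]))
    linarith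
  · have hQ : r ^ 2 * |gaussJet 2 e θ| ≤
        s ^ 2 * (2 * (r ^ 2 * gauss θ) + 4 * (r ^ 4 * gauss θ)) := by
      simp only [gaussJet, abs_mul, abs_of_nonneg hG0]
      calc r ^ 2 * (|dot e e - dot θ e ^ 2| * gauss θ)
          ≤ r ^ 2 * ((2 * s * s + (2 * r * s) ^ 2) * gauss θ) := by
            gcongr
            refine (abs_sub _ _).trans ?_
            rw [abs_pow]
            gcongr
        _ = _ := by ring
    refine key (s ^ 2) (by positivity) _ (2 * gauss θ + 4 * (r ^ 2 * gauss θ)) ?_ (by linarith) _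
      hQ (hQ.trans (le_of_eq (by ring)))
    linarith
  · have hQ : r ^ 3 * |gaussJet 3 e θ| ≤
        s ^ 3 * (8 * (r ^ 6 * gauss θ) + 12 * (r ^ 4 * gauss θ)) := by
      simp only [gaussJet, abs_mul, abs_of_nonneg hG0]
      calc r ^ 3 * (|dot θ e ^ 3 - 3 * dot θ e * dot e e| * gauss θ)
          ≤ r ^ 3 * (((2 * r * s) ^ 3 + 3 * (2 * r * s) * (2 * s * s)) * gauss θ) := by
            gcongr
            refine (abs_sub _ _).trans ?_
            rw [abs_pow, abs_mul, abs_mul]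
            gcongr
            norm_num
        _ = _ := by ring
    refine key (s ^ 3) (by positivity) _ (8 * (r ^ 4 * gauss θ) + 12 * (r ^ 2 * gauss θ)) ?_
      (by linarith) _ hQ (hQ.trans (le_of_eq (by ring)))
    linarith

/-- Quadratic smallness at the origin and boundedness at infinity allow every order between 0 and 2;
this uses `σ ≤ 2`. -/
lemma isSymbol_one_sub_gauss {k : ℕ} {σ : ℝ} (hk : Admissible k σ) :
    IsSymbol k σ {0}ᶜ (fun θ => 1 - gauss θ) := by
  have hk3 : k ≤ 3 := by rcases hk with ⟨rfl, -⟩ | ⟨rfl, -⟩ <;> norm_num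
  refine isSymbol_of_hasDerivAt (C := 500) (by norm_num) gaussJet (fun _ _ => rfl)
    (fun i hi e θ => hasDerivAt_gaussJet (by omega) e θ) ?_ ?_
  · intro e θ
    have h1 : Continuous fun t : ℝ => gauss (θ + t • e) := by fun_prop
    have h2 : Continuous fun t : ℝ => dot (θ + t • e) e := by unfold dot; fun_prop
    rcases k with _ | _ | _ | k <;> simp only [gaussJet] <;> fun_prop
  · intro i hi e θ hθ
    have hr : 0 < ‖θ‖ := norm_pos_iff.2 hθ
    obtain ⟨h1, h2⟩ := norm_pow_mul_abs_gaussJet_le (hi.trans hk3) e θ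
    have h3 : ‖θ‖ ^ i * |gaussJet i e θ| ≤ 500 * ‖e‖ ^ i * ‖θ‖ ^ σ := by
      rcases le_total ‖θ‖ 1 with h | h
      · refine h2.trans ?_
        have : ‖θ‖ ^ (2 : ℝ) ≤ ‖θ‖ ^ σ := Real.rpow_le_rpow_of_exponent_ge hr h hk.le_two
        rw [show ‖θ‖ ^ (2 : ℝ) = ‖θ‖ ^ 2 by exact_mod_cast Real.rpow_natCast ‖θ‖ 2] at this
        gcongr
      · refine h1.trans ?_
        have := Real.one_le_rpow h hk.pos.le
        gcongr
    rw [Real.rpow_sub hr, Real.rpow_natCast, ← mul_div_assoc, le_div_iff₀ (by positivity)]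
    linarith

/-! ### The Gaussian potential kernel -/

lemma integrable_exp_neg_mul_quad {t : ℝ} (ht : 0 < t) :
    Integrable fun θ : ℝ × ℝ => Real.exp (-(t * quad θ)) := by
  have h := (integrable_exp_neg_mul_sq (b := t / 2) (by linarith)).mul_prod
    (integrable_exp_neg_mul_sq (b := t / 2) (by linarith))
  rw [← Measure.volume_eq_prod] at h
  refine h.congr (Filter.Eventually.of_forall fun θ => ?_)
  simp only [← Real.exp_add, quad]
  congr 1; ring

lemma integrable_gauss : Integrable gauss := by
  simpa [gauss] using! integrable_exp_neg_mul_quad one_pos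

/-- Real part of a product of two one-dimensional complex Gaussian Fourier integrals. -/
lemma integral_cos_mul_exp_neg_quad {t : ℝ} (ht : 0 < t) (x : ℝ × ℝ) :
    ∫ θ, Real.cos (dot θ x) * Real.exp (-(t * quad θ)) =
      2 * Real.pi * (Real.exp (-(quad x / t)) / t) := by
  have hb : 0 < ((t / 2 : ℝ) : ℂ).re := by rw [Complex.ofReal_re]; linarith
  have hprod := integral_prod_mul (μ := (volume : Measure ℝ)) (ν := (volume : Measure ℝ))
    (fun a : ℝ => Complex.exp (Complex.I * x.1 * a) * Complex.exp (-((t / 2 : ℝ) : ℂ) * a ^ 2))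
    (fun a : ℝ => Complex.exp (Complex.I * x.2 * a) * Complex.exp (-((t / 2 : ℝ) : ℂ) * a ^ 2))
  rw [fourierIntegral_gaussian hb, fourierIntegral_gaussian hb, ← Measure.volume_eq_prod] at hprod
  have hfun : ∀ θ : ℝ × ℝ,
      Complex.exp (Complex.I * x.1 * θ.1) * Complex.exp (-((t / 2 : ℝ) : ℂ) * θ.1 ^ 2) *
      (Complex.exp (Complex.I * x.2 * θ.2) * Complex.exp (-((t / 2 : ℝ) : ℂ) * θ.2 ^ 2)) =
      Complex.exp ((dot θ x : ℝ) * Complex.I) * (Real.exp (-(t * quad θ)) : ℝ) := by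
    intro θ
    rw [Complex.ofReal_exp, ← Complex.exp_add, ← Complex.exp_add, ← Complex.exp_add,
      ← Complex.exp_add]
    congr 1
    simp only [dot, quad]
    push_cast
    ring
  simp only [hfun] at hprod
  have hint : Integrable fun θ : ℝ × ℝ =>
      Complex.exp ((dot θ x : ℝ) * Complex.I) * (Real.exp (-(t * quad θ)) : ℝ) := by
    refine (integrable_exp_neg_mul_quad ht).mono' ?_ (Filter.Eventually.of_forall fun θ => ?_)
    · have : Continuous fun θ : ℝ × ℝ => dot θ x := by unfold dot; fun_prop
      exact Continuous.aestronglyMeasurable (by fun_prop)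
    · rw [norm_mul, Complex.norm_exp_ofReal_mul_I, one_mul, Complex.norm_real,
        Real.norm_of_nonneg (Real.exp_pos _).le]
  have hre := integral_re hint
  rw [hprod] at hre
  have hleft : ∀ θ : ℝ × ℝ, RCLike.re (Complex.exp ((dot θ x : ℝ) * Complex.I) *
      (Real.exp (-(t * quad θ)) : ℝ)) = Real.cos (dot θ x) * Real.exp (-(t * quad θ)) := by
    intro θ
    rw [RCLike.re_eq_complex_re, Complex.re_mul_ofReal, Complex.exp_ofReal_mul_I_re]
  simp only [hleft] at hre
  rw [hre, RCLike.re_eq_complex_re]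
  have hval : ((Real.pi : ℂ) / ((t / 2 : ℝ) : ℂ)) ^ (1 / 2 : ℂ) *
      Complex.exp (-(x.1 : ℂ) ^ 2 / (4 * ((t / 2 : ℝ) : ℂ))) *
      (((Real.pi : ℂ) / ((t / 2 : ℝ) : ℂ)) ^ (1 / 2 : ℂ) *
      Complex.exp (-(x.2 : ℂ) ^ 2 / (4 * ((t / 2 : ℝ) : ℂ)))) =
      ((2 * Real.pi * (Real.exp (-(quad x / t)) / t) : ℝ) : ℂ) := by
    have hne : (Real.pi : ℂ) / ((t / 2 : ℝ) : ℂ) ≠ 0 := by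
      have : (Real.pi : ℂ) ≠ 0 := by exact_mod_cast Real.pi_ne_zero
      have : ((t / 2 : ℝ) : ℂ) ≠ 0 := by exact_mod_cast (by positivity : t / 2 ≠ 0)
      positivity
    have htc : (t : ℂ) ≠ 0 := by exact_mod_cast ht.ne'
    rw [mul_mul_mul_comm, ← Complex.cpow_add _ _ hne, ← Complex.exp_add]
    push_cast
    rw [show (1 / 2 : ℂ) + 1 / 2 = 1 by norm_num, Complex.cpow_one,
      show -(x.1 : ℂ) ^ 2 / (4 * (t / 2)) + -(x.2 : ℂ) ^ 2 / (4 * (t / 2)) = -((quad x : ℂ) / t) by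
        simp only [quad]; push_cast; field_simp; ring]
    field_simp
  rw [hval, Complex.ofReal_re]

/-- Subtracting the reference point cancels the non-integrable singularity of order `-2` at the
origin. -/
lemma abs_cos_sub_cos_le (θ x y : ℝ × ℝ) :
    |Real.cos (dot θ x) - Real.cos (dot θ y)| ≤ 2 * (‖x‖ ^ 2 + ‖y‖ ^ 2) * ‖θ‖ ^ 2 := by
  have key : ∀ z : ℝ × ℝ, 1 - Real.cos (dot θ z) ≤ 2 * ‖z‖ ^ 2 * ‖θ‖ ^ 2 := by
    intro z
    have h1 := Real.one_sub_sq_div_two_le_cos (x := dot θ z)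
    have h2 := abs_dot_le θ z
    have h3 : dot θ z ^ 2 ≤ (2 * ‖θ‖ * ‖z‖) ^ 2 := by
      rw [← sq_abs]; gcongr
    nlinarith
  have hx := key x
  have hy := key y
  have hx' := Real.cos_le_one (dot θ x)
  have hy' := Real.cos_le_one (dot θ y)
  have hx0 : 0 ≤ ‖x‖ ^ 2 * ‖θ‖ ^ 2 := by positivity
  have hy0 : 0 ≤ ‖y‖ ^ 2 * ‖θ‖ ^ 2 := by positivity
  rw [abs_le]
  constructor <;> nlinarith

/-- Starting the time integral at 1 instead of 0 produces the Gaussian factor that tames the kernel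
at infinity in `θ`. -/
lemma integral_exp_neg_mul_Ioi_one {q : ℝ} (hq : 0 < q) :
    IntegrableOn (fun t => Real.exp (-(t * q))) (Set.Ioi 1) ∧
    ∫ t in Set.Ioi (1 : ℝ), Real.exp (-(t * q)) = Real.exp (-q) / q := by
  have h : ∀ t : ℝ, -(t * q) = -q * t := fun t => by ring
  simp only [h]
  refine ⟨integrableOn_exp_mul_Ioi (by linarith) 1, ?_⟩
  rw [integral_exp_mul_Ioi (by linarith) 1]
  simp [neg_div_neg_eq]

/-- The Gaussian potential kernel as an integral over time. -/
lemma integral_cos_sub_cos_mul_gauss_div_quad (x y : ℝ × ℝ) :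
    ∫ θ, (Real.cos (dot θ x) - Real.cos (dot θ y)) * (gauss θ * (quad θ)⁻¹) =
      2 * Real.pi * ∫ t in Set.Ioi (1 : ℝ),
        (Real.exp (-(quad x / t)) - Real.exp (-(quad y / t))) / t := by
  set c : ℝ × ℝ → ℝ := fun θ => Real.cos (dot θ x) - Real.cos (dot θ y) with hc
  have hcc : Continuous c := by
    have h1 : Continuous fun θ : ℝ × ℝ => dot θ x := by unfold dot; fun_prop
    have h2 : Continuous fun θ : ℝ × ℝ => dot θ y := by unfold dot; fun_prop
    exact (Real.continuous_cos.comp h1).sub (Real.continuous_cos.comp h2)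
  have hne : ∀ᵐ θ : ℝ × ℝ, θ ≠ 0 := by
    simp [ae_iff]
  have hF : AEStronglyMeasurable (Function.uncurry fun (θ : ℝ × ℝ) (t : ℝ) =>
      c θ * Real.exp (-(t * quad θ))) (volume.prod (volume.restrict (Set.Ioi (1 : ℝ)))) := by
    refine Continuous.aestronglyMeasurable ?_
    show Continuous fun p : (ℝ × ℝ) × ℝ => c p.1 * Real.exp (-(p.2 * quad p.1))
    fun_prop
  have hnorm : ∀ θ : ℝ × ℝ, θ ≠ 0 →
      ∫ t in Set.Ioi (1 : ℝ), ‖c θ * Real.exp (-(t * quad θ))‖ =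
        |c θ| * (gauss θ * (quad θ)⁻¹) := by
    intro θ hθ
    simp only [norm_mul, Real.norm_eq_abs, Real.abs_exp]
    rw [integral_const_mul, (integral_exp_neg_mul_Ioi_one (quad_pos hθ)).2]
    rfl
  -- Fubini is justified because the difference of cosines is at most a multiple of `quad θ`,
  -- leaving a multiple of `gauss θ` after the integration in `t`.
  have hint : Integrable (Function.uncurry fun (θ : ℝ × ℝ) (t : ℝ) =>
      c θ * Real.exp (-(t * quad θ))) (volume.prod (volume.restrict (Set.Ioi (1 : ℝ)))) := by
    rw [integrable_prod_iff hF]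
    constructor
    · filter_upwards [hne] with θ hθ
      exact (integral_exp_neg_mul_Ioi_one (quad_pos hθ)).1.const_mul (c θ)
    · refine Integrable.mono' (integrable_gauss.const_mul (4 * (‖x‖ ^ 2 + ‖y‖ ^ 2)))
        hF.norm.integral_prod_right' ?_
      filter_upwards [hne] with θ hθ
      simp only [Function.uncurry]
      rw [hnorm θ hθ, Real.norm_eq_abs, abs_mul, abs_abs, abs_of_nonneg
        (mul_nonneg (gauss_pos θ).le (inv_nonneg.2 (quad_nonneg θ)))]
      have h1 := abs_cos_sub_cos_le θ x y
      have h2 := sq_norm_le_quad θ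
      have hq := quad_pos hθ
      calc |c θ| * (gauss θ * (quad θ)⁻¹)
          ≤ (4 * (‖x‖ ^ 2 + ‖y‖ ^ 2) * quad θ) * (gauss θ * (quad θ)⁻¹) := by
            have := gauss_pos θ
            gcongr
            calc |c θ| ≤ 2 * (‖x‖ ^ 2 + ‖y‖ ^ 2) * ‖θ‖ ^ 2 := h1
              _ ≤ 2 * (‖x‖ ^ 2 + ‖y‖ ^ 2) * (2 * quad θ) := by gcongr; linarith
              _ = _ := by ring
        _ = _ := by field_simp
  have hswap := integral_integral_swap hint
  have hleft : ∫ θ, ∫ t in Set.Ioi (1 : ℝ), c θ * Real.exp (-(t * quad θ)) =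
      ∫ θ, c θ * (gauss θ * (quad θ)⁻¹) := by
    refine integral_congr_ae ?_
    filter_upwards [hne] with θ hθ
    rw [integral_const_mul, (integral_exp_neg_mul_Ioi_one (quad_pos hθ)).2]
    rfl
  rw [← hleft, hswap, ← integral_const_mul]
  refine setIntegral_congr_fun measurableSet_Ioi fun t ht => ?_
  have ht0 : 0 < t := lt_trans one_pos ht
  have hi : ∀ z : ℝ × ℝ, Integrable fun θ => Real.cos (dot θ z) * Real.exp (-(t * quad θ)) := by
    intro z
    have h1 : Continuous fun θ : ℝ × ℝ => dot θ z := by unfold dot; fun_prop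
    exact (integrable_exp_neg_mul_quad ht0).bdd_mul (c := 1)
      (Continuous.aestronglyMeasurable (by fun_prop))
      (Filter.Eventually.of_forall fun θ => Real.abs_cos_le_one _)
  simp only [hc, sub_mul]
  rw [integral_sub (hi x) (hi y), integral_cos_mul_exp_neg_quad ht0,
    integral_cos_mul_exp_neg_quad ht0]
  ring

/-- The integrand is the derivative in `t` of `exp (-(η / t)) / η`. -/
lemma integral_Ioi_exp_neg_div_div_sq {η : ℝ} (hη : 0 < η) :
    ∫ t in Set.Ioi (1 : ℝ), Real.exp (-(η / t)) / t ^ 2 = (1 - Real.exp (-η)) / η := by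
  have hderiv : ∀ t ∈ Set.Ici (1 : ℝ),
      HasDerivAt (fun t => Real.exp (-(η / t)) / η) (Real.exp (-(η / t)) / t ^ 2) t := by
    intro t ht
    have ht0 : t ≠ 0 := by have : (1 : ℝ) ≤ t := ht; positivity
    have h := (((hasDerivAt_inv ht0).const_mul η).neg.exp).div_const η
    refine h.congr_deriv ?_
    simp only [Pi.neg_apply]
    rw [div_eq_mul_inv η t]
    field_simp
  have hlim : Filter.Tendsto (fun t => Real.exp (-(η / t)) / η) Filter.atTop (nhds (1 / η)) := by
    have h1 : Filter.Tendsto (fun t : ℝ => -(η / t)) Filter.atTop (nhds (-0)) :=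
      (Filter.Tendsto.const_div_atTop Filter.tendsto_id η).neg
    rw [neg_zero] at h1
    have h2 := ((Real.continuous_exp.tendsto 0).comp h1).div_const η
    rwa [Real.exp_zero] at h2
  rw [integral_Ioi_of_hasDerivAt_of_nonneg' hderiv (fun t _ => by positivity) hlim]
  simp [sub_div]

lemma integrableOn_inv_sq : IntegrableOn (fun t : ℝ => (t ^ 2)⁻¹) (Set.Ioi 1) := by
  refine (integrableOn_Ioi_rpow_of_lt (a := -2) (by norm_num) one_pos).congr_fun ?_
    measurableSet_Ioi
  intro t ht
  have : (0 : ℝ) < t := lt_trans one_pos ht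
  simp only
  rw [Real.rpow_neg this.le]
  norm_cast

/-- Write the difference of exponentials as an integral in `η` of its derivative and exchange the
integrals. The base point `1 / 2` is the value of `quad` at e₁. -/
lemma integral_exp_sub_exp_div {y : ℝ} (hy : 1 / 2 ≤ y) :
    ∫ t in Set.Ioi (1 : ℝ), (Real.exp (-(y / t)) - Real.exp (-((1 / 2) / t))) / t =
      -∫ η in (1 / 2)..y, (1 - Real.exp (-η)) / η := by
  have hint : Integrable (Function.uncurry fun (η t : ℝ) => Real.exp (-(η / t)) / t ^ 2)
      ((volume.restrict (Set.Ioc (1 / 2) y)).prod (volume.restrict (Set.Ioi (1 : ℝ)))) := by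
    have hdom : Integrable (fun p : ℝ × ℝ => (1 : ℝ) * (p.2 ^ 2)⁻¹)
        ((volume.restrict (Set.Ioc (1 / 2) y)).prod (volume.restrict (Set.Ioi (1 : ℝ)))) :=
      Integrable.mul_prod (f := fun _ : ℝ => (1 : ℝ)) (integrable_const _) integrableOn_inv_sq
    refine hdom.mono' ?_ ?_
    · refine Measurable.aestronglyMeasurable ?_
      show Measurable fun p : ℝ × ℝ => Real.exp (-(p.1 / p.2)) / p.2 ^ 2
      fun_prop
    · rw [Measure.prod_restrict]
      refine (ae_restrict_iff' (measurableSet_Ioc.prod measurableSet_Ioi)).2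
        (Filter.Eventually.of_forall fun p hp => ?_)
      have h1 : 0 < p.1 := lt_trans (by norm_num) hp.1.1
      have h2 : 0 < p.2 := lt_trans one_pos hp.2
      rw [Function.uncurry, Real.norm_of_nonneg (by positivity), div_eq_mul_inv]
      gcongr
      exact Real.exp_le_one_iff.2 (by have := div_pos h1 h2; linarith)
  have hswap := integral_integral_swap hint
  rw [intervalIntegral.integral_of_le hy]
  have hL : ∫ η in Set.Ioc (1 / 2) y, (1 - Real.exp (-η)) / η =
      ∫ η in Set.Ioc (1 / 2) y, ∫ t in Set.Ioi (1 : ℝ), Real.exp (-(η / t)) / t ^ 2 := by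
    refine setIntegral_congr_fun measurableSet_Ioc fun η hη => ?_
    exact (integral_Ioi_exp_neg_div_div_sq (lt_trans (by norm_num) hη.1)).symm
  rw [hL, hswap, ← integral_neg]
  refine setIntegral_congr_fun measurableSet_Ioi fun t ht => ?_
  have ht0 : (0 : ℝ) < t := lt_trans one_pos ht
  rw [← intervalIntegral.integral_of_le hy]
  have hderiv : ∀ η ∈ Set.uIcc (1 / 2) y,
      HasDerivAt (fun η => -(Real.exp (-(η / t)) / t)) (Real.exp (-(η / t)) / t ^ 2) η := by
    intro η _
    have h := (((hasDerivAt_id η).div_const t).neg.exp.div_const t).neg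
    refine h.congr_deriv ?_
    simp only [Pi.neg_apply, id]
    field_simp
  rw [intervalIntegral.integral_eq_sub_of_hasDerivAt hderiv
    (Continuous.intervalIntegrable (by fun_prop) _ _)]
  ring

/-- The term 1/η gives the logarithm; the term exp(-η)/η is integrable at infinity, its full
integral from `1 / 2` is `L`, and its tail is the error. -/
lemma exists_integral_one_sub_exp_div : ∃ L : ℝ, ∀ y : ℝ, 1 / 2 ≤ y →
    |(∫ η in (1 / 2)..y, (1 - Real.exp (-η)) / η) - (Real.log (2 * y) - L)| ≤ 2 / y := by
  have hintIoi : IntegrableOn (fun η : ℝ => Real.exp (-η) / η) (Set.Ioi (1 / 2)) := by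
    have h1 : IntegrableOn (fun η : ℝ => 2 * Real.exp (-η)) (Set.Ioi (1 / 2)) := by
      have := (integrableOn_exp_mul_Ioi (a := -1) (by norm_num) (1 / 2)).const_mul 2
      simpa only [neg_one_mul] using! this
    refine Integrable.mono' h1 (Measurable.aestronglyMeasurable (by fun_prop)) ?_
    refine (ae_restrict_iff' measurableSet_Ioi).2 (Filter.Eventually.of_forall fun η hη => ?_)
    have hη' : (1 : ℝ) / 2 < η := hη
    rw [Real.norm_of_nonneg (by positivity), div_le_iff₀ (by linarith)]
    nlinarith [Real.exp_pos (-η)]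
  refine ⟨∫ η in Set.Ioi (1 / 2), Real.exp (-η) / η, fun y hy => ?_⟩
  have hy0 : 0 < y := by linarith
  have hpos : ∀ η ∈ Set.uIcc (1 / 2) y, η ≠ 0 := by
    intro η hη
    rw [Set.uIcc_of_le hy] at hη
    have := hη.1
    positivity
  have hsplit : ∫ η in (1 / 2)..y, (1 - Real.exp (-η)) / η =
      Real.log (2 * y) - ∫ η in (1 / 2)..y, Real.exp (-η) / η := by
    have h0 : (0 : ℝ) ∉ Set.uIcc (1 / 2) y := fun h => hpos 0 h rfl
    have h1 : ∫ η in (1 / 2)..y, η⁻¹ = Real.log (2 * y) := by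
      rw [integral_inv h0]
      congr 1; field_simp
    rw [← h1, ← intervalIntegral.integral_sub]
    · refine intervalIntegral.integral_congr fun η _ => ?_
      simp only [sub_div, one_div]
    · exact ContinuousOn.intervalIntegrable (continuousOn_inv₀.mono fun η hη => hpos η hη)
    · exact ContinuousOn.intervalIntegrable
        ((Continuous.continuousOn (by fun_prop)).div continuousOn_id hpos)
  have htail : (∫ η in Set.Ioi (1 / 2), Real.exp (-η) / η) -
      ∫ η in (1 / 2)..y, Real.exp (-η) / η = ∫ η in Set.Ioi y, Real.exp (-η) / η := by
    rw [intervalIntegral.integral_of_le hy, ← Set.Ioc_union_Ioi_eq_Ioi hy,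
      setIntegral_union (Set.Ioc_disjoint_Ioi le_rfl) measurableSet_Ioi
      (hintIoi.mono_set Set.Ioc_subset_Ioi_self) (hintIoi.mono_set (Set.Ioi_subset_Ioi hy))]
    ring
  rw [hsplit, show ∀ a b c : ℝ, a - b - (a - c) = c - b by intros; ring, htail]
  have hnn : 0 ≤ ∫ η in Set.Ioi y, Real.exp (-η) / η := by
    refine setIntegral_nonneg measurableSet_Ioi fun η hη => ?_
    have : 0 < η := hy0.trans hη
    positivity
  rw [abs_of_nonneg hnn]
  have hint2 : IntegrableOn (fun η : ℝ => Real.exp (-1 * η)) (Set.Ioi y) :=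
    integrableOn_exp_mul_Ioi (by norm_num) y
  calc ∫ η in Set.Ioi y, Real.exp (-η) / η
      ≤ ∫ η in Set.Ioi y, y⁻¹ * Real.exp (-1 * η) := by
        refine setIntegral_mono_on (hintIoi.mono_set (Set.Ioi_subset_Ioi hy))
          (hint2.const_mul _) measurableSet_Ioi fun η hη => ?_
        have h1 : y < η := hη
        rw [div_eq_inv_mul, neg_one_mul]
        gcongr
    _ = y⁻¹ * Real.exp (-y) := by
        rw [integral_const_mul, integral_exp_mul_Ioi (by norm_num)]
        norm_num
    _ ≤ y⁻¹ * 1 := by gcongr; exact Real.exp_le_one_iff.2 (by linarith)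
    _ ≤ 2 / y := by rw [mul_one, inv_eq_one_div]; gcongr; norm_num

/-- Asymptotics of the Gaussian potential kernel. -/
lemma exists_gaussian_kernel_asymptotics {y : ℝ × ℝ} (hy : quad y = 1 / 2) :
    ∃ κ : ℝ, ∀ x : ℝ × ℝ, 1 / 2 ≤ quad x →
      |(∫ θ, (Real.cos (dot θ x) - Real.cos (dot θ y)) * (gauss θ * (quad θ)⁻¹)) -
        (κ - 2 * Real.pi * Real.log (2 * quad x))| ≤ 4 * Real.pi / quad x := by
  obtain ⟨L, hL⟩ := exists_integral_one_sub_exp_div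
  refine ⟨2 * Real.pi * L, fun x hx => ?_⟩
  rw [integral_cos_sub_cos_mul_gauss_div_quad, hy, integral_exp_sub_exp_div hx]
  set I := ∫ η in (1 / 2)..quad x, (1 - Real.exp (-η)) / η
  have h := hL (quad x) hx
  rw [show 2 * Real.pi * -I - (2 * Real.pi * L - 2 * Real.pi * Real.log (2 * quad x)) =
    -(2 * Real.pi * (I - (Real.log (2 * quad x) - L))) by ring, abs_neg, abs_mul,
    abs_of_pos Real.two_pi_pos]
  calc _ ≤ 2 * Real.pi * (2 / quad x) := by gcongr
    _ = _ := by ring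

/-! ### Decay of Fourier transforms of symbols by finite differences -/

/-- The mean value inequality turns one difference into one derivative; the induction peels off the
innermost difference. -/
lemma abs_fwdDiff_iter_le (k : ℕ) : ∀ {g : ℝ → ℝ} {a M : ℝ},
    (∀ t ∈ Set.Icc a (a + k), ContDiffAt ℝ k g t) →
    (∀ t ∈ Set.Icc a (a + k), |iteratedDeriv k g t| ≤ M) → |(fwdDiff 1)^[k] g a| ≤ M := by
  induction k with
  | zero =>
    intro g a M _ h
    simpa using h a (by simp)
  | succ k ih =>
    intro g a M hg h
    rw [Function.iterate_succ_apply]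
    have hmem : ∀ t ∈ Set.Icc a (a + k), Set.Icc t (t + 1) ⊆ Set.Icc a (a + (k + 1 : ℕ)) := by
      intro t ht
      refine Set.Icc_subset_Icc ht.1 ?_
      push_cast
      linarith [ht.2]
    have hk : ((k : ℕ) : WithTop ℕ∞) ≤ ((k + 1 : ℕ) : WithTop ℕ∞) := by
      exact_mod_cast Nat.le_succ k
    have hg1 : ∀ t ∈ Set.Icc a (a + k), ContDiffAt ℝ k (fun s => g (s + 1)) t := by
      intro t ht
      have h1 := (hg (t + 1) (hmem t ht ⟨by linarith, le_rfl⟩)).of_le hk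
      exact ContDiffAt.comp t h1 (by fun_prop)
    have hg0 : ∀ t ∈ Set.Icc a (a + k), ContDiffAt ℝ k g t := fun t ht =>
      (hg t (hmem t ht ⟨le_rfl, by linarith⟩)).of_le hk
    refine ih (fun t ht => (hg1 t ht).sub (hg0 t ht)) fun t ht => ?_
    have heq : iteratedDeriv k (fwdDiff 1 g) t =
        iteratedDeriv k g (t + 1) - iteratedDeriv k g t := by
      have := iteratedDeriv_fun_sub (hg1 t ht) (hg0 t ht)
      rw [iteratedDeriv_comp_add_const] at this
      exact this
    rw [heq]
    have hmvt := Convex.norm_image_sub_le_of_norm_deriv_le (f := iteratedDeriv k g)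
      (s := Set.Icc t (t + 1)) (x := t) (y := t + 1) (C := M)
      (fun s hs => ?_) (fun s hs => ?_) (convex_Icc _ _) ⟨le_rfl, by linarith⟩ ⟨by linarith, le_rfl⟩
    · simpa using hmvt
    · have hs' := hg s (hmem t ht hs)
      have h1 := ContDiffWithinAt.differentiableWithinAt_iteratedDerivWithin (m := k)
        hs'.contDiffWithinAt (s := Set.univ) (by exact_mod_cast Nat.lt_succ_self k)
        (by simp)
      rwa [iteratedDerivWithin_univ, differentiableWithinAt_univ] at h1
    · rw [← iteratedDeriv_succ]
      exact h s (hmem t ht hs)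

lemma integrable_fwdDiff_iter {F : ℝ × ℝ → ℝ} (hF : Integrable F) (h : ℝ × ℝ) (k : ℕ) :
    Integrable ((fwdDiff h)^[k] F) := by
  induction k generalizing F with
  | zero => exact hF
  | succ k ih => exact ih ((hF.comp_add_right h).sub hF)

lemma Integrable.cos_dot_mul {F : ℝ × ℝ → ℝ} (hF : Integrable F) (x : ℝ × ℝ) :
    Integrable fun θ => Real.cos (dot θ x) * F θ := by
  have h1 : Continuous fun θ : ℝ × ℝ => dot θ x := by unfold dot; fun_prop
  exact hF.bdd_mul (c := 1) (Continuous.aestronglyMeasurable (by fun_prop))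
    (Filter.Eventually.of_forall fun θ => Real.abs_cos_le_one _)

/-- A shift by `h` changes the sign of the cosine, so each difference multiplies the integral by
`-2`. -/
lemma integral_cos_mul_fwdDiff_iter {F : ℝ × ℝ → ℝ} (hF : Integrable F) {h x : ℝ × ℝ}
    (hx : dot h x = Real.pi) (k : ℕ) :
    ∫ θ, Real.cos (dot θ x) * (fwdDiff h)^[k] F θ =
      (-2) ^ k * ∫ θ, Real.cos (dot θ x) * F θ := by
  induction k generalizing F with
  | zero => simp
  | succ k ih =>
    have hFh : Integrable fun θ => F (θ + h) := hF.comp_add_right h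
    have hΔ : Integrable (fwdDiff h F) := hFh.sub hF
    rw [Function.iterate_succ_apply, ih hΔ]
    have hshift : ∫ θ, Real.cos (dot θ x) * F (θ + h) = -∫ θ, Real.cos (dot θ x) * F θ := by
      rw [← integral_neg, ← integral_add_right_eq_self
        (fun θ => -(Real.cos (dot θ x) * F θ)) h]
      refine integral_congr_ae (Filter.Eventually.of_forall fun θ => ?_)
      simp only [dot_add_left, hx, Real.cos_add_pi]
      ring
    have hsub : ∫ θ, Real.cos (dot θ x) * fwdDiff h F θ =
        (∫ θ, Real.cos (dot θ x) * F (θ + h)) - ∫ θ, Real.cos (dot θ x) * F θ := by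
      rw [← integral_sub (Integrable.cos_dot_mul hFh x) (Integrable.cos_dot_mul hF x)]
      refine integral_congr_ae (Filter.Eventually.of_forall fun θ => ?_)
      simp only [fwdDiff]
      ring
    rw [hsub, hshift, pow_succ]
    ring

/-- For use near the singularity, where derivatives are useless: each difference doubles the
integral at most and enlarges the ball by `‖h‖`. -/
lemma setIntegral_abs_fwdDiff_iter_le {F : ℝ × ℝ → ℝ} (hF : Integrable F) (h : ℝ × ℝ) (k : ℕ)
    (r : ℝ) : ∫ θ in Metric.closedBall 0 r, |(fwdDiff h)^[k] F θ| ≤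
      2 ^ k * ∫ θ in Metric.closedBall 0 (r + k * ‖h‖), |F θ| := by
  induction k generalizing F with
  | zero => simp
  | succ k ih =>
    have hFh : Integrable fun θ => F (θ + h) := hF.comp_add_right h
    rw [Function.iterate_succ_apply]
    refine (ih (hFh.sub hF)).trans ?_
    set R := r + k * ‖h‖ with hR
    have hR' : r + ((k + 1 : ℕ) : ℝ) * ‖h‖ = R + ‖h‖ := by rw [hR]; push_cast; ring
    rw [hR', pow_succ, mul_assoc]
    refine mul_le_mul_of_nonneg_left ?_ (by positivity)
    have hshift : ∫ θ in Metric.closedBall 0 R, |F (θ + h)| ≤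
        ∫ θ in Metric.closedBall 0 (R + ‖h‖), |F θ| := by
      rw [← integral_indicator Metric.isClosed_closedBall.measurableSet,
        ← integral_indicator Metric.isClosed_closedBall.measurableSet,
        ← integral_add_right_eq_self
          ((Metric.closedBall (0 : ℝ × ℝ) (R + ‖h‖)).indicator fun θ => |F θ|) h]
      refine integral_mono (hFh.abs.indicator Metric.isClosed_closedBall.measurableSet)
        ((hF.abs.indicator Metric.isClosed_closedBall.measurableSet).comp_add_right h) fun θ => ?_
      by_cases hθ : θ ∈ Metric.closedBall (0 : ℝ × ℝ) R
      · have hθ' : θ + h ∈ Metric.closedBall (0 : ℝ × ℝ) (R + ‖h‖) := by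
          rw [mem_closedBall_zero_iff] at hθ ⊢
          exact (norm_add_le _ _).trans (by linarith)
        rw [Set.indicator_of_mem hθ, Set.indicator_of_mem hθ']
      · rw [Set.indicator_of_notMem hθ]
        exact Set.indicator_nonneg (fun _ _ => abs_nonneg _) _
    have hmono : ∫ θ in Metric.closedBall 0 R, |F θ| ≤
        ∫ θ in Metric.closedBall 0 (R + ‖h‖), |F θ| :=
      setIntegral_mono_set hF.abs.integrableOn
        (Filter.Eventually.of_forall fun _ => abs_nonneg _)
        (Metric.closedBall_subset_closedBall (by linarith [norm_nonneg h])).eventuallyLE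
    calc ∫ θ in Metric.closedBall 0 R, |fwdDiff h F θ|
        ≤ ∫ θ in Metric.closedBall 0 R, (|F (θ + h)| + |F θ|) :=
          integral_mono (hFh.sub hF).abs.integrableOn (hFh.abs.add hF.abs).integrableOn
            fun θ => abs_sub _ _
      _ = (∫ θ in Metric.closedBall 0 R, |F (θ + h)|) +
            ∫ θ in Metric.closedBall 0 R, |F θ| :=
          integral_add hFh.abs.integrableOn hF.abs.integrableOn
      _ ≤ _ := by linarith

/-- Polar coordinates for the sup norm: in dimension 2 the radial density contributes one power, and
the constant is twice the area of the unit ball. -/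
lemma setIntegral_closedBall_norm_rpow {σ r : ℝ} (hσ : 0 < σ) (hr : 0 ≤ r) :
    IntegrableOn (fun θ : ℝ × ℝ => ‖θ‖ ^ (σ - 2)) (Metric.closedBall 0 r) ∧
    ∫ θ in Metric.closedBall (0 : ℝ × ℝ) r, ‖θ‖ ^ (σ - 2) =
      2 * volume.real (Metric.ball (0 : ℝ × ℝ) 1) * (r ^ σ / σ) := by
  have hset : Metric.closedBall (0 : ℝ × ℝ) r = (fun θ => ‖θ‖) ⁻¹' Set.Iic r := by
    ext θ; simp
  have hind : (Metric.closedBall (0 : ℝ × ℝ) r).indicator (fun θ : ℝ × ℝ => ‖θ‖ ^ (σ - 2)) =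
      fun θ => (Set.Iic r).indicator (fun y => y ^ (σ - 2)) ‖θ‖ := by
    funext θ; rw [hset]; rfl
  have hfin : Module.finrank ℝ (ℝ × ℝ) = 2 := by simp
  have hrad : ∀ y ∈ Set.Ioi (0 : ℝ), y ^ (Module.finrank ℝ (ℝ × ℝ) - 1) •
      (Set.Iic r).indicator (fun y => y ^ (σ - 2)) y =
        (Set.Iic r).indicator (fun y => y ^ (σ - 1)) y := by
    intro y hy
    rw [hfin]
    by_cases h : y ∈ Set.Iic r
    · rw [Set.indicator_of_mem h, Set.indicator_of_mem h, smul_eq_mul, ← Real.rpow_natCast,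
        ← Real.rpow_add hy]
      congr 1; push_cast; ring
    · rw [Set.indicator_of_notMem h, Set.indicator_of_notMem h, smul_zero]
  have hint : IntegrableOn (fun y : ℝ => y ^ (σ - 1)) (Set.Ioc 0 r) :=
    (intervalIntegrable_iff_integrableOn_Ioc_of_le hr).1
      (intervalIntegral.intervalIntegrable_rpow' (by linarith))
  constructor
  · rw [← integrable_indicator_iff Metric.isClosed_closedBall.measurableSet, hind,
      integrable_fun_norm_addHaar volume (f := (Set.Iic r).indicator fun y => y ^ (σ - 2)),
      integrableOn_congr_fun hrad measurableSet_Ioi, IntegrableOn,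
      integrable_indicator_iff measurableSet_Iic, IntegrableOn,
      Measure.restrict_restrict measurableSet_Iic, Set.inter_comm, Set.Ioi_inter_Iic]
    exact hint
  · rw [← integral_indicator Metric.isClosed_closedBall.measurableSet, hind,
      integral_fun_norm_addHaar volume ((Set.Iic r).indicator fun y => y ^ (σ - 2)),
      setIntegral_congr_fun measurableSet_Ioi hrad, setIntegral_indicator measurableSet_Iic,
      Set.Ioi_inter_Iic, ← intervalIntegral.integral_of_le hr,
      integral_rpow (Or.inl (by linarith)), hfin]
    simp [Real.zero_rpow hσ.ne']
    ring

lemma setIntegral_compl_closedBall_norm_rpow {β r : ℝ} (hβ : β < 0) (hr : 0 < r) :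
    IntegrableOn (fun θ : ℝ × ℝ => ‖θ‖ ^ (β - 2)) (Metric.closedBall 0 r)ᶜ ∧
    ∫ θ in (Metric.closedBall (0 : ℝ × ℝ) r)ᶜ, ‖θ‖ ^ (β - 2) =
      2 * volume.real (Metric.ball (0 : ℝ × ℝ) 1) * (-r ^ β / β) := by
  have hms : MeasurableSet (Metric.closedBall (0 : ℝ × ℝ) r)ᶜ :=
    Metric.isClosed_closedBall.measurableSet.compl
  have hset : (Metric.closedBall (0 : ℝ × ℝ) r)ᶜ = (fun θ => ‖θ‖) ⁻¹' Set.Ioi r := by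
    ext θ; simp
  have hind : (Metric.closedBall (0 : ℝ × ℝ) r)ᶜ.indicator (fun θ : ℝ × ℝ => ‖θ‖ ^ (β - 2)) =
      fun θ => (Set.Ioi r).indicator (fun y => y ^ (β - 2)) ‖θ‖ := by
    funext θ; rw [hset]; rfl
  have hfin : Module.finrank ℝ (ℝ × ℝ) = 2 := by simp
  have hrad : ∀ y ∈ Set.Ioi (0 : ℝ), y ^ (Module.finrank ℝ (ℝ × ℝ) - 1) •
      (Set.Ioi r).indicator (fun y => y ^ (β - 2)) y =
        (Set.Ioi r).indicator (fun y => y ^ (β - 1)) y := by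
    intro y hy
    rw [hfin]
    by_cases h : y ∈ Set.Ioi r
    · rw [Set.indicator_of_mem h, Set.indicator_of_mem h, smul_eq_mul, ← Real.rpow_natCast,
        ← Real.rpow_add hy]
      congr 1; push_cast; ring
    · rw [Set.indicator_of_notMem h, Set.indicator_of_notMem h, smul_zero]
  have hinter : Set.Ioi (0 : ℝ) ∩ Set.Ioi r = Set.Ioi r := by
    rw [Set.Ioi_inter_Ioi, sup_eq_right.2 hr.le]
  constructor
  · rw [← integrable_indicator_iff hms, hind,
      integrable_fun_norm_addHaar volume (f := (Set.Ioi r).indicator fun y => y ^ (β - 2)),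
      integrableOn_congr_fun hrad measurableSet_Ioi, IntegrableOn,
      integrable_indicator_iff measurableSet_Ioi, IntegrableOn,
      Measure.restrict_restrict measurableSet_Ioi, Set.inter_comm, hinter]
    exact integrableOn_Ioi_rpow_of_lt (by linarith) hr
  · rw [← integral_indicator hms, hind,
      integral_fun_norm_addHaar volume ((Set.Ioi r).indicator fun y => y ^ (β - 2)),
      setIntegral_congr_fun measurableSet_Ioi hrad, setIntegral_indicator measurableSet_Ioi,
      hinter, integral_Ioi_rpow_of_lt (by linarith) hr, hfin]
    simp
    ring

/-- The Fourier transform of an integrable symbol of order `σ - 2` on the punctured plane decays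
like `‖x‖ ^ (-σ)`. -/
lemma IsSymbol.exists_abs_integral_cos_mul_le {k : ℕ} {σ : ℝ} (hσ : 0 < σ) (hσk : σ < k)
    {H : ℝ × ℝ → ℝ} (hH : Integrable H) (hsym : IsSymbol k (σ - 2) {0}ᶜ H) :
    ∃ C : ℝ, ∀ x : ℝ × ℝ, x ≠ 0 → |∫ θ, Real.cos (dot θ x) * H θ| ≤ C * ‖x‖ ^ (-σ) := by
  obtain ⟨B, hB, hbound⟩ := hsym.abs_le
  obtain ⟨D, hD, hderiv⟩ := hsym
  have hk0 : (0 : ℝ) < k := hσ.trans hσk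
  set v := volume.real (Metric.ball (0 : ℝ × ℝ) 1) with hv
  have hv0 : 0 ≤ v := measureReal_nonneg
  -- The two summands are the constants of the near and the far estimate; the power of 2 in the
  -- second comes from replacing `‖θ‖` by `‖θ‖ / 2`.
  set A : ℝ := 2 ^ k * (B * (2 * v * ((3 * k) ^ σ / σ))) +
    D * 2 ^ (2 + k - σ) * (2 * v * ((2 * k) ^ (σ - k) / (k - σ))) with hA
  have hA0 : 0 ≤ A := by
    have h1 : 0 < (k : ℝ) - σ := by linarith
    positivity
  refine ⟨A * Real.pi ^ σ, fun x hx => ?_⟩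
  have hxn : 0 < ‖x‖ := norm_pos_iff.2 hx
  have hq : 0 < quad x := quad_pos hx
  -- The multiple of `x` whose pairing with `x` is π; its length is at most `π / ‖x‖`.
  set h : ℝ × ℝ := (Real.pi / (2 * quad x)) • x with hh
  have hdot : dot h x = Real.pi := by
    rw [hh, dot_smul_left, show dot x x = 2 * quad x by simp [dot, quad]; ring]
    field_simp
  set s := ‖h‖ with hs
  have hpi := Real.pi_pos
  have hs_eq : s = Real.pi / (2 * quad x) * ‖x‖ := by
    rw [hs, hh, norm_smul, Real.norm_of_nonneg (by positivity)]
  have hs0 : 0 < s := by rw [hs_eq]; positivity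
  have hsle : s ≤ Real.pi / ‖x‖ := by
    rw [hs_eq, div_mul_eq_mul_div, div_le_div_iff₀ (by positivity) hxn]
    have := sq_norm_le_quad x
    nlinarith
  have hmeas : MeasurableSet (Metric.closedBall (0 : ℝ × ℝ) (2 * k * s)) :=
    Metric.isClosed_closedBall.measurableSet
  have hΔ := integrable_fwdDiff_iter hH h k
  have hne : ∀ᵐ θ : ℝ × ℝ, θ ≠ 0 := by simp [ae_iff]
  have hnear : ∫ θ in Metric.closedBall 0 (2 * k * s), |(fwdDiff h)^[k] H θ| ≤
      2 ^ k * (B * (2 * v * ((3 * k) ^ σ / σ))) * s ^ σ := by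
    refine (setIntegral_abs_fwdDiff_iter_le hH h k _).trans ?_
    rw [← hs, show 2 * k * s + k * s = 3 * k * s by ring]
    obtain ⟨hi, he⟩ := setIntegral_closedBall_norm_rpow (r := 3 * k * s) hσ (by positivity)
    have : ∫ θ in Metric.closedBall 0 (3 * k * s), |H θ| ≤
        ∫ θ in Metric.closedBall (0 : ℝ × ℝ) (3 * k * s), B * ‖θ‖ ^ (σ - 2) := by
      refine integral_mono_ae hH.abs.integrableOn (hi.const_mul B) ?_
      filter_upwards [ae_restrict_of_ae hne] with θ hθ using hbound θ hθ
    rw [integral_const_mul, he, Real.mul_rpow (by positivity) hs0.le] at this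
    calc _ ≤ 2 ^ k * (B * (2 * v * ((3 * k) ^ σ * s ^ σ / σ))) := by gcongr
      _ = _ := by ring
  have hfar : ∫ θ in (Metric.closedBall 0 (2 * k * s))ᶜ, |(fwdDiff h)^[k] H θ| ≤
      D * 2 ^ (2 + k - σ) * (2 * v * ((2 * k) ^ (σ - k) / (k - σ))) * s ^ σ := by
    obtain ⟨hi, he⟩ := setIntegral_compl_closedBall_norm_rpow (β := σ - k) (r := 2 * k * s)
      (by linarith) (by positivity)
    -- Outside radius `2 * k * s` the whole segment from `θ` to `θ + k • h` stays at distance at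
    -- least `‖θ‖ / 2` from the origin, so the symbol bound on the k-th derivative applies along it.
    have hpt : ∀ θ ∈ (Metric.closedBall (0 : ℝ × ℝ) (2 * k * s))ᶜ, |(fwdDiff h)^[k] H θ| ≤
        D * 2 ^ (2 + k - σ) * s ^ k * ‖θ‖ ^ (σ - k - 2) := by
      intro θ hθ
      have hθ' : 2 * k * s < ‖θ‖ := by simpa using hθ
      have hθ0 : 0 < ‖θ‖ := lt_trans (by positivity) hθ'
      have hline : ∀ (j : ℕ) (F : ℝ × ℝ → ℝ), (fwdDiff h)^[j] F θ =
          (fwdDiff (1 : ℝ))^[j] (fun t : ℝ => F (θ + t • h)) 0 := by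
        intro j F
        rw [fwdDiff_iter_eq_sum_shift, fwdDiff_iter_eq_sum_shift]
        refine Finset.sum_congr rfl fun i _ => ?_
        congr 2
        simp [Nat.cast_smul_eq_nsmul]
      have hfar : ∀ t ∈ Set.Icc (0 : ℝ) (0 + k), ‖θ‖ / 2 ≤ ‖θ + t • h‖ := by
        intro t ht
        rw [zero_add] at ht
        have h1 : ‖t • h‖ ≤ k * s := by
          rw [norm_smul, Real.norm_of_nonneg ht.1]
          exact mul_le_mul_of_nonneg_right ht.2 hs0.le
        have h2 : ‖θ‖ ≤ ‖θ + t • h‖ + ‖t • h‖ := by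
          simpa using norm_sub_le (θ + t • h) (t • h)
        linarith
      have hshift : ∀ t : ℝ, (fun u : ℝ => H (θ + t • h + u • h)) =
          fun u : ℝ => (fun t : ℝ => H (θ + t • h)) (t + u) := by
        intro t; funext u; simp only [add_smul, add_assoc]
      rw [hline]
      refine abs_fwdDiff_iter_le k (fun t ht => ?_) fun t ht => ?_
      · have hpos : 0 < ‖θ + t • h‖ := by linarith [hfar t ht]
        have h1 := (hderiv (θ + t • h) (norm_pos_iff.1 hpos) h).1
        have h2 : ContDiffAt ℝ k (fun u : ℝ => H (θ + t • h + u • h)) (t - t) := by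
          rwa [sub_self]
        have h3 := ContDiffAt.comp t h2 (f := fun u : ℝ => u - t) (by fun_prop)
        refine h3.congr_of_eventuallyEq (Filter.Eventually.of_forall fun u => ?_)
        simp only [Function.comp]
        congr 1
        module
      · have hlow := hfar t ht
        have hpos : 0 < ‖θ + t • h‖ := by linarith
        have h1 := (hderiv (θ + t • h) (norm_pos_iff.1 hpos) h).2 k le_rfl
        rw [hshift, congrFun (iteratedDeriv_comp_const_add k (fun t : ℝ => H (θ + t • h)) t) 0,
          add_zero] at h1
        refine h1.trans ?_
        have h2 : ‖θ + t • h‖ ^ (σ - 2 - k) ≤ (‖θ‖ / 2) ^ (σ - 2 - k) :=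
          Real.rpow_le_rpow_of_nonpos (by positivity) hlow (by linarith)
        calc D * ‖h‖ ^ k * ‖θ + t • h‖ ^ (σ - 2 - k)
            ≤ D * s ^ k * (‖θ‖ / 2) ^ (σ - 2 - k) := by gcongr
          _ = D * s ^ k * (‖θ‖ ^ (σ - k - 2) * 2 ^ (2 + k - σ)) := by
              rw [Real.div_rpow hθ0.le (by norm_num), div_eq_mul_inv,
                ← Real.rpow_neg (by norm_num)]
              congr 3 <;> ring_nf
          _ = _ := by ring
    have hle : ∫ θ in (Metric.closedBall 0 (2 * k * s))ᶜ, |(fwdDiff h)^[k] H θ| ≤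
        ∫ θ in (Metric.closedBall (0 : ℝ × ℝ) (2 * k * s))ᶜ,
          D * 2 ^ (2 + k - σ) * s ^ k * ‖θ‖ ^ (σ - k - 2) :=
      setIntegral_mono_on hΔ.abs.integrableOn (hi.const_mul _) hmeas.compl hpt
    rw [integral_const_mul, he, Real.mul_rpow (by positivity) hs0.le] at hle
    refine hle.trans (le_of_eq ?_)
    have h1 : s ^ σ = s ^ k * s ^ (σ - k) := by
      rw [← Real.rpow_natCast, ← Real.rpow_add hs0]; congr 1; ring
    have h2 : (k : ℝ) - σ ≠ 0 := by linarith
    have h3 : σ - (k : ℝ) ≠ 0 := by linarith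
    rw [← hv, h1, show σ - (k : ℝ) = -(k - σ) by ring]
    field_simp
  have htotal : ∫ θ, |(fwdDiff h)^[k] H θ| ≤ A * s ^ σ := by
    rw [← integral_add_compl hmeas hΔ.abs, hA, add_mul]
    exact add_le_add hnear hfar
  have hI : |∫ θ, Real.cos (dot θ x) * H θ| ≤ ∫ θ, |(fwdDiff h)^[k] H θ| := by
    have h1 := integral_cos_mul_fwdDiff_iter hH hdot k
    have h2 : |∫ θ, Real.cos (dot θ x) * (fwdDiff h)^[k] H θ| ≤ ∫ θ, |(fwdDiff h)^[k] H θ| := by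
      rw [← Real.norm_eq_abs]
      refine norm_integral_le_of_norm_le hΔ.abs (Filter.Eventually.of_forall fun θ => ?_)
      rw [norm_mul]
      exact mul_le_of_le_one_left (norm_nonneg _) (Real.abs_cos_le_one _)
    rw [h1, abs_mul, abs_pow, abs_neg, abs_two] at h2
    refine le_trans ?_ h2
    exact le_mul_of_one_le_left (abs_nonneg _) (one_le_pow₀ (by norm_num))
  calc _ ≤ A * s ^ σ := hI.trans htotal
    _ ≤ A * (Real.pi / ‖x‖) ^ σ := by gcongr
    _ = _ := by
        rw [Real.div_rpow hpi.le hxn.le, Real.rpow_neg hxn.le]; ring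

/-! ### Characteristic functions and Fourier inversion on the lattice -/

section Lattice

variable {Ω : Type*} [MeasurableSpace Ω]

/-- The characteristic function of a symmetric random vector with values in `ℤ²`. -/
noncomputable def charFn (P : Measure Ω) (Y : Ω → ℤ × ℤ) (θ : ℝ × ℝ) : ℝ :=
  ∫ ω, Real.cos (dot θ (toPlane (Y ω))) ∂P

lemma measurable_comp_lattice {E : Type*} [MeasurableSpace E] {Y : Ω → ℤ × ℤ} (hY : Measurable Y)
    (f : ℤ × ℤ → E) : Measurable fun ω => f (Y ω) :=
  (measurable_of_countable f).comp hY

lemma measurable_toPlane_comp {Y : Ω → ℤ × ℤ} (hY : Measurable Y) :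
    Measurable fun ω => toPlane (Y ω) := measurable_comp_lattice hY toPlane

@[simp]
lemma toPlane_add (a b : ℤ × ℤ) : toPlane (a + b) = toPlane a + toPlane b := by
  simp [toPlane]

@[simp]
lemma toPlane_neg (a : ℤ × ℤ) : toPlane (-a) = -toPlane a := by
  simp [toPlane]

@[simp]
lemma toPlane_sub (a b : ℤ × ℤ) : toPlane (a - b) = toPlane a - toPlane b := by
  simp [toPlane]

lemma dot_add_right (θ a b : ℝ × ℝ) : dot θ (a + b) = dot θ a + dot θ b := by
  simp [dot]; ring

lemma dot_sub_right (θ a b : ℝ × ℝ) : dot θ (a - b) = dot θ a - dot θ b := by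
  simp [dot]; ring

lemma dot_neg_right (θ a : ℝ × ℝ) : dot θ (-a) = -dot θ a := by
  simp [dot]; ring

lemma toPlane_ne_zero {x : ℤ × ℤ} (hx : x ≠ 0) : toPlane x ≠ 0 := by
  contrapose! hx
  rw [toPlane, Prod.mk_eq_zero] at hx
  exact Prod.ext (by exact_mod_cast hx.1) (by exact_mod_cast hx.2)

lemma integral_sin_dot_eq_zero {P : Measure Ω} {Y : Ω → ℤ × ℤ} (hsymm : IsSymmetric P Y)
    (θ : ℝ × ℝ) :
    ∫ ω, Real.sin (dot θ (toPlane (Y ω))) ∂P = 0 := by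
  have h := (IdentDistrib.comp hsymm (u := fun z : ℤ × ℤ => Real.sin (dot θ (toPlane z)))
    (measurable_comp_lattice measurable_id fun z => Real.sin (dot θ (toPlane z)))).integral_eq
  simp only [Function.comp_def, toPlane_neg, dot_neg_right, Real.sin_neg, integral_neg] at h
  linarith

section ProbabilityMeasure

variable {P : Measure Ω} [IsProbabilityMeasure P]

lemma abs_charFn_le_one (Y : Ω → ℤ × ℤ) (θ : ℝ × ℝ) : |charFn P Y θ| ≤ 1 := by
  have h := norm_integral_le_of_norm_le_const (μ := P)
    (f := fun ω => Real.cos (dot θ (toPlane (Y ω)))) (C := 1)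
    (Filter.Eventually.of_forall fun ω => Real.abs_cos_le_one _)
  simpa [charFn] using h

lemma integrable_cos_dot {Y : Ω → ℤ × ℤ} (hY : Measurable Y) (θ : ℝ × ℝ) :
    Integrable (fun ω => Real.cos (dot θ (toPlane (Y ω)))) P :=
  Integrable.of_bound (measurable_comp_lattice hY fun z =>
    Real.cos (dot θ (toPlane z))).aestronglyMeasurable 1
    (Filter.Eventually.of_forall fun _ => Real.abs_cos_le_one _)

lemma integrable_sin_dot {Y : Ω → ℤ × ℤ} (hY : Measurable Y) (θ : ℝ × ℝ) :
    Integrable (fun ω => Real.sin (dot θ (toPlane (Y ω)))) P :=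
  Integrable.of_bound (measurable_comp_lattice hY fun z =>
    Real.sin (dot θ (toPlane z))).aestronglyMeasurable 1
    (Filter.Eventually.of_forall fun _ => Real.abs_sin_le_one _)

lemma continuous_charFn {Y : Ω → ℤ × ℤ} (hY : Measurable Y) : Continuous (charFn P Y) := by
  refine continuous_of_dominated (bound := fun _ => 1)
    (fun θ => (integrable_cos_dot hY θ).aestronglyMeasurable)
    (fun θ => Filter.Eventually.of_forall fun ω => Real.abs_cos_le_one _)
    (integrable_const _) (Filter.Eventually.of_forall fun ω => ?_)
  unfold dot
  fun_prop

lemma integral_cexp_dot {Y : Ω → ℤ × ℤ} (hY : Measurable Y) (θ : ℝ × ℝ) :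
    ∫ ω, Complex.exp ((dot θ (toPlane (Y ω)) : ℝ) * Complex.I) ∂P =
      (∫ ω, Real.cos (dot θ (toPlane (Y ω))) ∂P : ℝ) +
      (∫ ω, Real.sin (dot θ (toPlane (Y ω))) ∂P : ℝ) * Complex.I := by
  rw [← integral_complex_ofReal, ← integral_complex_ofReal, ← integral_mul_const,
    ← integral_add (integrable_cos_dot hY θ).ofReal ((integrable_sin_dot hY θ).ofReal.mul_const _)]
  refine integral_congr_ae (Filter.Eventually.of_forall fun ω => ?_)
  simp only [Complex.exp_mul_I, Complex.ofReal_cos, Complex.ofReal_sin]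

lemma measurable_walk {ξ : ℕ → Ω → ℤ × ℤ} (hmeas : ∀ i, Measurable (ξ i)) (n : ℕ) :
    Measurable (walk ξ n) :=
  Finset.measurable_sum _ fun i _ => hmeas i

/-- Independence is used with complex exponentials, which are multiplicative; symmetry makes each
factor real. -/
lemma integral_cexp_dot_walk {ξ : ℕ → Ω → ℤ × ℤ} (hmeas : ∀ i, Measurable (ξ i))
    (hindep : iIndepFun ξ P) (hident : ∀ i, IdentDistrib (ξ i) (ξ 0) P P)
    (hsymm : IsSymmetric P (ξ 0)) (n : ℕ) (θ : ℝ × ℝ) :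
    ∫ ω, Complex.exp ((dot θ (toPlane (walk ξ n ω)) : ℝ) * Complex.I) ∂P =
      ((charFn P (ξ 0) θ ^ n : ℝ) : ℂ) := by
  set E : ℤ × ℤ → ℂ := fun z => Complex.exp ((dot θ (toPlane z) : ℝ) * Complex.I) with hE
  have hEm : Measurable E := measurable_comp_lattice measurable_id E
  have hone : ∀ i, ∫ ω, E (ξ i ω) ∂P = (charFn P (ξ 0) θ : ℂ) := by
    intro i
    have h1 := ((hident i).comp hEm).integral_eq
    simp only [Function.comp_def] at h1
    rw [h1, hE]
    simp only
    rw [integral_cexp_dot (hmeas 0), integral_sin_dot_eq_zero hsymm]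
    simp [charFn]
  induction n with
  | zero => simp [walk, toPlane, dot]
  | succ n ih =>
    have hsplit : ∀ ω, Complex.exp ((dot θ (toPlane (walk ξ (n + 1) ω)) : ℝ) * Complex.I) =
        E (walk ξ n ω) * E (ξ n ω) := by
      intro ω
      rw [hE]
      simp only [walk, Finset.sum_range_succ, toPlane_add, dot_add_right]
      rw [← Complex.exp_add]
      push_cast
      ring_nf
    have hind : IndepFun (fun ω => E (walk ξ n ω)) (fun ω => E (ξ n ω)) P := by
      have h1 := hindep.indepFun_finsetSum_of_notMem hmeas
        (s := Finset.range n) (i := n) (by simp)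
      have h2 := h1.comp hEm hEm
      have h3 : (E ∘ ∑ j ∈ Finset.range n, ξ j) = fun ω => E (walk ξ n ω) := by
        funext ω; simp [walk, Finset.sum_apply]
      rw [h3] at h2
      exact h2
    simp only [hsplit]
    rw [hind.integral_fun_mul_eq_mul_integral
      (hEm.comp (measurable_walk hmeas n)).aestronglyMeasurable
      (hEm.comp (hmeas n)).aestronglyMeasurable, hone n, pow_succ, Complex.ofReal_mul, ← ih]

/-- The sine expectation of the walk is the imaginary part of a real number, so only the product of
cosines survives in the addition formula. -/
lemma integral_cos_dot_walk_sub {ξ : ℕ → Ω → ℤ × ℤ} (hmeas : ∀ i, Measurable (ξ i))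
    (hindep : iIndepFun ξ P) (hident : ∀ i, IdentDistrib (ξ i) (ξ 0) P P)
    (hsymm : IsSymmetric P (ξ 0)) (n : ℕ) (θ : ℝ × ℝ) (x : ℤ × ℤ) :
    ∫ ω, Real.cos (dot θ (toPlane (walk ξ n ω - x))) ∂P =
      charFn P (ξ 0) θ ^ n * Real.cos (dot θ (toPlane x)) := by
  have h := integral_cexp_dot_walk hmeas hindep hident hsymm n θ
  have hw := measurable_walk hmeas n
  rw [integral_cexp_dot hw] at h
  have hre := congrArg Complex.re h
  have him := congrArg Complex.im h
  simp only [Complex.add_re, Complex.add_im, Complex.ofReal_re, Complex.ofReal_im,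
    Complex.re_ofReal_mul, Complex.im_ofReal_mul, Complex.I_re, Complex.I_im, mul_zero, mul_one,
    add_zero, zero_add] at hre him
  simp only [toPlane_sub, dot_sub_right, Real.cos_sub]
  rw [integral_add ((integrable_cos_dot hw θ).mul_const _) ((integrable_sin_dot hw θ).mul_const _),
    integral_mul_const, integral_mul_const, him]
  rw [hre]
  ring

/-- Fourier inversion on the lattice. -/
lemma measureReal_eq_integral_bump {S : Ω → ℤ × ℤ} (hS : Measurable S) (x : ℤ × ℤ) :
    (2 * Real.pi) ^ 2 * P.real {ω | S ω = x} =
      ∫ θ, bump θ * ∫ ω, Real.cos (dot θ (toPlane (S ω - x))) ∂P := by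
  have hjoint : Integrable (Function.uncurry fun (ω : Ω) (θ : ℝ × ℝ) =>
      bump θ * Real.cos (dot θ (toPlane (S ω - x)))) (P.prod volume) := by
    have h1 : Integrable (fun p : Ω × (ℝ × ℝ) => (1 : ℝ) * bump p.2) (P.prod volume) :=
      Integrable.mul_prod (f := fun _ : Ω => (1 : ℝ)) (integrable_const _) integrable_bump
    refine h1.mono ?_ (Filter.Eventually.of_forall fun p => ?_)
    · refine Measurable.aestronglyMeasurable ?_
      have hm : Measurable fun p : Ω × (ℝ × ℝ) => toPlane (S p.1 - x) :=
        (measurable_comp_lattice hS fun z => toPlane (z - x)).comp measurable_fst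
      have hb : Measurable fun p : Ω × (ℝ × ℝ) => bump p.2 :=
        continuous_bump.measurable.comp measurable_snd
      have hd : Measurable fun p : Ω × (ℝ × ℝ) => dot p.2 (toPlane (S p.1 - x)) := by
        unfold dot
        fun_prop
      exact hb.mul (Real.measurable_cos.comp hd)
    · rw [Function.uncurry, norm_mul, one_mul]
      exact mul_le_of_le_one_right (norm_nonneg _) (Real.abs_cos_le_one _)
  have hswap := integral_integral_swap hjoint
  simp only [integral_const_mul] at hswap
  rw [← hswap]
  -- After the exchange, the integral in `θ` equals (2π)² where `S = x` and vanishes elsewhere.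
  simp only [integral_bump_mul_cos, sub_eq_zero]
  have hset : MeasurableSet {ω | S ω = x} := hS (measurableSet_singleton x)
  have hind : (fun ω => if S ω = x then (2 * Real.pi) ^ 2 else 0) =
      {ω | S ω = x}.indicator fun _ => (2 * Real.pi) ^ 2 := by
    funext ω
    simp [Set.indicator_apply]
  rw [hind, integral_indicator_const _ hset, smul_eq_mul, mul_comm]

lemma transProb_eq_integral {ξ : ℕ → Ω → ℤ × ℤ} (hmeas : ∀ i, Measurable (ξ i))
    (hindep : iIndepFun ξ P) (hident : ∀ i, IdentDistrib (ξ i) (ξ 0) P P)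
    (hsymm : IsSymmetric P (ξ 0)) (n : ℕ) (x : ℤ × ℤ) :
    (2 * Real.pi) ^ 2 * transProb P ξ n 0 x =
      ∫ θ, bump θ * (charFn P (ξ 0) θ ^ n * Real.cos (dot θ (toPlane x))) := by
  simp only [transProb, zero_add]
  rw [measureReal_eq_integral_bump (measurable_walk hmeas n)]
  simp only [integral_cos_dot_walk_sub hmeas hindep hident hsymm]

/-- The points of the lattice on which the character `θ` is trivial. -/
def characterKernel (θ : ℝ × ℝ) : AddSubgroup (ℤ × ℤ) where
  carrier := {z | ∃ m : ℤ, (m : ℝ) * (2 * Real.pi) = dot θ (toPlane z)}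
  zero_mem' := ⟨0, by simp [dot, toPlane]⟩
  add_mem' := by
    rintro a b ⟨m, hm⟩ ⟨n, hn⟩
    exact ⟨m + n, by rw [toPlane_add, dot_add_right, ← hm, ← hn]; push_cast; ring⟩
  neg_mem' := by
    rintro a ⟨m, hm⟩
    exact ⟨-m, by rw [toPlane_neg, dot_neg_right, ← hm]; push_cast; ring⟩

lemma mem_characterKernel {θ : ℝ × ℝ} {z : ℤ × ℤ} :
    z ∈ characterKernel θ ↔ ∃ m : ℤ, (m : ℝ) * (2 * Real.pi) = dot θ (toPlane z) := Iff.rfl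

/-- Testing on the two basis vectors makes both coordinates multiples of 2π, too small to be
nonzero. -/
lemma eq_zero_of_characterKernel_eq_top {θ : ℝ × ℝ} (h : characterKernel θ = ⊤)
    (hθ : ‖θ‖ < 2 * Real.pi) : θ = 0 := by
  have key : ∀ (m : ℤ) (a : ℝ), |a| ≤ ‖θ‖ → (m : ℝ) * (2 * Real.pi) = a → a = 0 := by
    intro m a ha hm
    have h1 : |(m : ℝ)| * (2 * Real.pi) < 1 * (2 * Real.pi) := by
      rw [one_mul, ← abs_of_pos Real.two_pi_pos, ← abs_mul, hm, abs_of_pos Real.two_pi_pos]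
      linarith
    have h2 : |(m : ℝ)| < 1 := lt_of_mul_lt_mul_right h1 Real.two_pi_pos.le
    have h3 : |m| < 1 := by exact_mod_cast h2
    rw [Int.abs_lt_one_iff] at h3
    rw [← hm, h3]; simp
  obtain ⟨m, hm⟩ := mem_characterKernel.1 (h ▸ AddSubgroup.mem_top ((1, 0) : ℤ × ℤ))
  obtain ⟨n, hn⟩ := mem_characterKernel.1 (h ▸ AddSubgroup.mem_top ((0, 1) : ℤ × ℤ))
  simp only [dot, toPlane, Int.cast_one, Int.cast_zero, mul_one, mul_zero, add_zero,
    zero_add] at hm hn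
  exact Prod.ext (key m _ (norm_fst_le θ) hm) (key n _ (norm_snd_le θ) hn)

/-- If the modulus is 1, the cosine is almost surely a constant sign ε. All atoms then differ from a
given one by elements of the kernel of the character, which strong aperiodicity forces to be
everything. -/
lemma abs_charFn_lt_one {Y : Ω → ℤ × ℤ} (hY : Measurable Y) (haper : StronglyAperiodic P Y)
    {θ : ℝ × ℝ} (hθ0 : θ ≠ 0) (hθ : ‖θ‖ < 2 * Real.pi) : |charFn P Y θ| < 1 := by
  refine lt_of_le_of_ne (abs_charFn_le_one Y θ) fun habs => hθ0 ?_
  obtain ⟨ε, hε, hφ⟩ : ∃ ε : ℝ, ε ^ 2 = 1 ∧ charFn P Y θ = ε :=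
    ⟨_, by rw [← sq_abs, habs, one_pow], rfl⟩
  have hε1 : |ε| = 1 := by rw [← hφ, habs]
  have hae : ∀ᵐ ω ∂P, Real.cos (dot θ (toPlane (Y ω))) = ε := by
    have hint : Integrable (fun ω => 1 - ε * Real.cos (dot θ (toPlane (Y ω)))) P :=
      (integrable_const 1).sub ((integrable_cos_dot hY θ).const_mul ε)
    have hnn : 0 ≤ fun ω => 1 - ε * Real.cos (dot θ (toPlane (Y ω))) := by
      intro ω
      have h1 : |ε * Real.cos (dot θ (toPlane (Y ω)))| ≤ 1 := by
        rw [abs_mul, hε1, one_mul]; exact Real.abs_cos_le_one _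
      simpa using (le_abs_self _).trans h1
    have hzero : ∫ ω, (1 - ε * Real.cos (dot θ (toPlane (Y ω)))) ∂P = 0 := by
      rw [integral_sub (integrable_const 1) ((integrable_cos_dot hY θ).const_mul ε),
        integral_const_mul]
      have : ∫ ω, Real.cos (dot θ (toPlane (Y ω))) ∂P = ε := hφ
      rw [this]
      simp only [integral_const, probReal_univ, smul_eq_mul, mul_one]
      nlinarith
    filter_upwards [(integral_eq_zero_iff_of_nonneg hnn hint).1 hzero] with ω hω
    have h1 : 1 - ε * Real.cos (dot θ (toPlane (Y ω))) = 0 := hω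
    have h2 : ε * (ε * Real.cos (dot θ (toPlane (Y ω)))) = Real.cos (dot θ (toPlane (Y ω))) := by
      rw [← mul_assoc, ← sq, hε, one_mul]
    rw [← h2]
    linear_combination (-ε) * h1
  have hsupp : ∀ y, P {ω | Y ω = y} ≠ 0 → Real.cos (dot θ (toPlane y)) = ε := by
    intro y hy
    by_contra hne
    refine hy (measure_mono_null (fun ω hω => ?_) hae)
    have hω' : Y ω = y := hω
    simpa [hω'] using hne
  have hsin : ∀ a : ℝ, Real.cos a = ε → Real.sin a = 0 := by
    intro a ha
    have h1 := Real.sin_sq_add_cos_sq a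
    rw [ha, hε] at h1
    exact pow_eq_zero_iff two_ne_zero |>.1 (by linarith)
  refine eq_zero_of_characterKernel_eq_top (top_le_iff.1 ?_) hθ
  -- Translate by minus an atom. Without atoms the generating set is empty and the inclusion is
  -- vacuous, so the existence of an atom need not be proved.
  by_cases hex : ∃ y₀, P {ω | Y ω = y₀} ≠ 0
  · obtain ⟨y₀, hy₀⟩ := hex
    rw [← haper (-y₀), AddSubgroup.closure_le]
    rintro z ⟨y, hy, rfl⟩
    refine mem_characterKernel.2 ((Real.cos_eq_one_iff _).1 ?_)
    have h1 := hsupp y hy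
    have h0 := hsupp y₀ hy₀
    rw [toPlane_add, toPlane_neg, dot_add_right, dot_neg_right, Real.cos_add, Real.cos_neg,
      h0, h1, hsin _ h1]
    linarith [hε, sq ε]
  · rw [← haper 0, AddSubgroup.closure_le]
    rintro z ⟨y, hy, -⟩
    exact absurd ⟨y, hy⟩ hex

end ProbabilityMeasure

end Lattice

/-! ### Behaviour of the characteristic function near and away from the origin -/

section CharacteristicFunction

variable {Ω : Type*} [MeasurableSpace Ω] {P : Measure Ω} [IsProbabilityMeasure P]
  {Y : Ω → ℤ × ℤ} {k : ℕ} {σ : ℝ}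

/-- The identity covariance makes the expected quadratic Taylor term exactly `quad θ`. -/
lemma one_sub_charFn_eq (hY : Measurable Y)
    (hmom : Integrable (fun ω => ‖toPlane (Y ω)‖ ^ (2 : ℕ)) P)
    (h11 : ∫ ω, ((Y ω).1 : ℝ) ^ 2 ∂P = 1) (h22 : ∫ ω, ((Y ω).2 : ℝ) ^ 2 ∂P = 1)
    (h12 : ∫ ω, ((Y ω).1 : ℝ) * (Y ω).2 ∂P = 0) (θ : ℝ × ℝ) :
    1 - charFn P Y θ = quad θ + ∫ ω, cosRem 0 (dot θ (toPlane (Y ω))) ∂P := by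
  have hle : ∀ (f : ℤ × ℤ → ℝ), (∀ z, |f z| ≤ ‖toPlane z‖ ^ 2) →
      Integrable (fun ω => f (Y ω)) P := fun f hf =>
    hmom.mono' (measurable_comp_lattice hY f).aestronglyMeasurable
      (Filter.Eventually.of_forall fun ω => hf (Y ω))
  have hfst : ∀ z : ℤ × ℤ, |(z.1 : ℝ)| ≤ ‖toPlane z‖ := fun z => norm_fst_le (toPlane z)
  have hsnd : ∀ z : ℤ × ℤ, |(z.2 : ℝ)| ≤ ‖toPlane z‖ := fun z => norm_snd_le (toPlane z)
  have i11 : Integrable (fun ω => ((Y ω).1 : ℝ) ^ 2) P := hle (fun z => (z.1 : ℝ) ^ 2) fun z => by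
    rw [abs_pow]; gcongr; exact hfst z
  have i22 : Integrable (fun ω => ((Y ω).2 : ℝ) ^ 2) P := hle (fun z => (z.2 : ℝ) ^ 2) fun z => by
    rw [abs_pow]; gcongr; exact hsnd z
  have i12 : Integrable (fun ω => ((Y ω).1 : ℝ) * (Y ω).2) P :=
    hle (fun z => (z.1 : ℝ) * z.2) fun z => by
      rw [abs_mul, sq]
      exact mul_le_mul (hfst z) (hsnd z) (abs_nonneg _) (norm_nonneg _)
  have hexp : ∀ ω, cosRem 0 (dot θ (toPlane (Y ω))) =
      1 - Real.cos (dot θ (toPlane (Y ω))) - (θ.1 ^ 2 / 2 * ((Y ω).1 : ℝ) ^ 2 +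
        θ.2 ^ 2 / 2 * ((Y ω).2 : ℝ) ^ 2 + θ.1 * θ.2 * (((Y ω).1 : ℝ) * (Y ω).2)) := by
    intro ω
    simp only [cosRem, dot, toPlane]
    ring
  have hcos := integrable_cos_dot (P := P) hY θ
  have j11 := i11.const_mul (θ.1 ^ 2 / 2)
  have j22 := i22.const_mul (θ.2 ^ 2 / 2)
  have j12 := i12.const_mul (θ.1 * θ.2)
  have j0 : Integrable (fun ω => 1 - Real.cos (dot θ (toPlane (Y ω)))) P :=
    (integrable_const 1).sub hcos
  have j1 : Integrable (fun ω => θ.1 ^ 2 / 2 * ((Y ω).1 : ℝ) ^ 2 +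
      θ.2 ^ 2 / 2 * ((Y ω).2 : ℝ) ^ 2) P := j11.add j22
  have j2 : Integrable (fun ω => θ.1 ^ 2 / 2 * ((Y ω).1 : ℝ) ^ 2 +
      θ.2 ^ 2 / 2 * ((Y ω).2 : ℝ) ^ 2 + θ.1 * θ.2 * (((Y ω).1 : ℝ) * (Y ω).2)) P := j1.add j12
  simp only [hexp]
  rw [integral_sub j0 j2, integral_sub (integrable_const 1) hcos, integral_add j1 j12,
    integral_add j11 j22, integral_const_mul, integral_const_mul, integral_const_mul, h11, h22,
    h12]
  simp only [integral_const, probReal_univ, smul_eq_mul, mul_one, mul_zero, add_zero, quad, charFn]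
  ring

/-- The characteristic function stays away from `±1` quadratically. -/
lemma exists_mul_sq_norm_le_one_sub_abs_charFn (hY : Measurable Y)
    (haper : StronglyAperiodic P Y) {w : ℝ × ℝ → ℝ} (hσ : 0 < σ)
    (hw : IsSymbol k (2 + σ) {0}ᶜ w) (hφ : ∀ θ, 1 - charFn P Y θ = quad θ + w θ) {R : ℝ}
    (hR : R < 2 * Real.pi) :
    ∃ c : ℝ, 0 < c ∧ ∀ θ : ℝ × ℝ, ‖θ‖ ≤ R → c * ‖θ‖ ^ 2 ≤ 1 - |charFn P Y θ| := by
  obtain ⟨C, hC, hwC⟩ := hw.abs_le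
  -- Within radius `r` the remainder is at most `‖θ‖ ^ 2 / 4`, half of the lower bound for `quad θ`;
  -- `r ≤ 1 / 2` also makes the characteristic function nonnegative there, so its absolute value is
  -- harmless.
  obtain ⟨r, hr0, hr1, hrC⟩ : ∃ r : ℝ, 0 < r ∧ r ≤ 1 / 2 ∧ C * r ^ σ ≤ 1 / 4 := by
    have hlim : Filter.Tendsto (fun r : ℝ => C * r ^ σ) (nhdsWithin 0 (Set.Ioi 0)) (nhds 0) := by
      have h1 : ContinuousAt (fun r : ℝ => C * r ^ σ) 0 :=
        continuousAt_const.mul (Real.continuousAt_rpow_const 0 σ (Or.inr hσ.le))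
      have h2 := h1.tendsto
      rw [Real.zero_rpow hσ.ne', mul_zero] at h2
      exact h2.mono_left nhdsWithin_le_nhds
    have h3 := (hlim.eventually (eventually_le_nhds (by norm_num : (0 : ℝ) < 1 / 4))).and
      (Ioc_mem_nhdsGT (by norm_num : (0 : ℝ) < 1 / 2))
    obtain ⟨r, h4, h5⟩ := h3.exists
    exact ⟨r, h5.1, h5.2, h4⟩
  have hnear : ∀ θ : ℝ × ℝ, ‖θ‖ ≤ r → 1 / 4 * ‖θ‖ ^ 2 ≤ 1 - |charFn P Y θ| := by
    intro θ hθ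
    rcases eq_or_ne θ 0 with rfl | hne
    · simpa using abs_charFn_le_one (P := P) Y 0
    have hpos := norm_pos_iff.2 hne
    have h1 := hwC θ hne
    have h2 : C * ‖θ‖ ^ (2 + σ) ≤ 1 / 4 * ‖θ‖ ^ 2 := by
      rw [Real.rpow_add hpos, show ‖θ‖ ^ (2 : ℝ) = ‖θ‖ ^ 2 by
        exact_mod_cast Real.rpow_natCast ‖θ‖ 2]
      have h3 : C * ‖θ‖ ^ σ ≤ 1 / 4 := le_trans (by gcongr) hrC
      nlinarith [sq_nonneg ‖θ‖]
    have h4 := abs_le.1 (h1.trans h2)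
    have h5 := sq_norm_le_quad θ
    have h6 := quad_le θ
    have h7 := hφ θ
    have h8 : ‖θ‖ ^ 2 ≤ 1 / 4 := by nlinarith
    have h9 : 0 ≤ charFn P Y θ := by linarith [h4.1, h4.2]
    rw [abs_of_nonneg h9]
    linarith [h4.1]
  -- On the compact annulus between `r` and `R` continuity gives a positive minimum; `R < 2π`
  -- excludes the other points of the dual lattice.
  obtain ⟨a, ha0, ha⟩ := ((isCompact_closedBall (0 : ℝ × ℝ) R).diff
    (Metric.isOpen_ball (x := (0 : ℝ × ℝ)) (ε := r))).exists_forall_le'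
    (f := fun θ => 1 - |charFn P Y θ|)
    (continuous_const.sub (continuous_charFn hY).abs).continuousOn (a := 0) (by
      rintro θ ⟨h1, h2⟩
      rw [mem_closedBall_zero_iff] at h1
      rw [mem_ball_zero_iff, not_lt] at h2
      have h3 := abs_charFn_lt_one hY haper (norm_pos_iff.1 (hr0.trans_le h2))
        (h1.trans_lt hR)
      simpa using h3)
  refine ⟨min (1 / 4) (a / (2 * Real.pi) ^ 2), by positivity, fun θ hθ => ?_⟩
  rcases le_or_gt ‖θ‖ r with h | h
  · refine le_trans ?_ (hnear θ h)
    gcongr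
    exact min_le_left _ _
  · have h1 := ha θ ⟨by simpa using hθ, by simpa using h.le⟩
    refine le_trans ?_ h1
    calc min (1 / 4) (a / (2 * Real.pi) ^ 2) * ‖θ‖ ^ 2
        ≤ a / (2 * Real.pi) ^ 2 * (2 * Real.pi) ^ 2 := by
          gcongr
          · exact min_le_right _ _
          · exact hθ.trans hR.le
      _ = a := by field_simp

end CharacteristicFunction

/-! ### Summing the series under the integral -/

lemma mul_sq_norm_pos_and_le_of_bump_ne_zero {φ c R : ℝ} {θ : ℝ × ℝ} (hR : 3 * Real.pi / 2 ≤ R)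
    (hc : 0 < c) (hlow : ‖θ‖ ≤ R → c * ‖θ‖ ^ 2 ≤ 1 - |φ|) (hθ : θ ≠ 0) (hb : bump θ ≠ 0) :
    0 < c * ‖θ‖ ^ 2 ∧ c * ‖θ‖ ^ 2 ≤ 1 - |φ| := by
  have hpos := norm_pos_iff.2 hθ
  refine ⟨by positivity, hlow ?_⟩
  by_contra hgt
  exact hb (bump_eq_zero (by linarith))

section Series

variable {φ : ℝ × ℝ → ℝ} {c R : ℝ}

lemma Integrable.bump_mul {f : ℝ × ℝ → ℝ} {B : ℝ} (hf : AEStronglyMeasurable f volume)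
    (hb : ∀ᵐ θ, |bump θ * f θ| ≤ B * bump θ) : Integrable fun θ => bump θ * f θ :=
  (integrable_bump.const_mul B).mono' (continuous_bump.aestronglyMeasurable.mul hf) hb

lemma ae_ne_zero : ∀ᵐ θ : ℝ × ℝ, θ ≠ 0 := by simp [ae_iff]

lemma continuous_cos_sub_cos (x y : ℝ × ℝ) :
    Continuous fun θ => Real.cos (dot θ x) - Real.cos (dot θ y) := by
  unfold dot; fun_prop

/-- Summation of the powers of `φ` under the integral sign. -/
lemma hasSum_integral_pow_mul_cos_sub_cos (hφ : Continuous φ) (hc : 0 < c)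
    (hR : 3 * Real.pi / 2 ≤ R) (hlow : ∀ θ : ℝ × ℝ, ‖θ‖ ≤ R → c * ‖θ‖ ^ 2 ≤ 1 - |φ θ|)
    (x y : ℝ × ℝ) :
    HasSum (fun n : ℕ => ∫ θ, bump θ *
      (φ θ ^ (n + 1) * (Real.cos (dot θ x) - Real.cos (dot θ y))))
      (∫ θ, bump θ * (φ θ * (1 - φ θ)⁻¹ * (Real.cos (dot θ x) - Real.cos (dot θ y)))) := by
  set B : ℝ := 2 * (‖x‖ ^ 2 + ‖y‖ ^ 2) with hB
  have hB0 : 0 ≤ B := by positivity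
  set D : ℝ × ℝ → ℝ := fun θ => Real.cos (dot θ x) - Real.cos (dot θ y) with hD
  have hDc : Continuous D := continuous_cos_sub_cos x y
  have hDB : ∀ θ, |D θ| ≤ B * ‖θ‖ ^ 2 := fun θ => abs_cos_sub_cos_le θ x y
  have hF : ∀ n : ℕ, Integrable fun θ => bump θ * (φ θ ^ (n + 1) * D θ) := fun n =>
    Continuous.integrable_of_hasCompactSupport
      (continuous_bump.mul ((hφ.pow _).mul hDc)) hasCompactSupport_bump.mul_right
  have hpt : ∀ θ : ℝ × ℝ, θ ≠ 0 → bump θ ≠ 0 → HasSum (fun n : ℕ => φ θ ^ (n + 1))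
      (φ θ * (1 - φ θ)⁻¹) := by
    intro θ hθ hb
    obtain ⟨h1, h2⟩ := mul_sq_norm_pos_and_le_of_bump_ne_zero hR hc (hlow θ) hθ hb
    have h3 := (hasSum_geometric_of_abs_lt_one (r := φ θ) (by linarith)).mul_left (φ θ)
    simpa only [← pow_succ'] using h3
  -- Uniform domination of the partial sums of absolute values: the factor `‖θ‖ ^ 2` from the
  -- cosines cancels the one in the bound for the geometric series.
  have hpart : ∀ (N : ℕ) (θ : ℝ × ℝ), θ ≠ 0 →
      ∑ n ∈ Finset.range N, ‖bump θ * (φ θ ^ (n + 1) * D θ)‖ ≤ B / c * bump θ := by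
    intro N θ hθ
    rcases eq_or_ne (bump θ) 0 with hb | hb
    · simp [hb]
    obtain ⟨h1, h2⟩ := mul_sq_norm_pos_and_le_of_bump_ne_zero hR hc (hlow θ) hθ hb
    have hb0 := bump_nonneg θ
    have h3 : |φ θ| < 1 := by linarith
    have hgeom : ∑ n ∈ Finset.range N, |φ θ| ^ (n + 1) ≤ (1 - |φ θ|)⁻¹ := by
      calc _ ≤ ∑ n ∈ Finset.range N, |φ θ| ^ n :=
            Finset.sum_le_sum fun n _ =>
              pow_le_pow_of_le_one (abs_nonneg _) h3.le (Nat.le_succ n)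
        _ ≤ ∑' n : ℕ, |φ θ| ^ n :=
            (summable_geometric_of_lt_one (abs_nonneg _) h3).sum_le_tsum _
              fun n _ => by positivity
        _ = _ := tsum_geometric_of_lt_one (abs_nonneg _) h3
    have hpos := norm_pos_iff.2 hθ
    calc _ = bump θ * |D θ| * ∑ n ∈ Finset.range N, |φ θ| ^ (n + 1) := by
          rw [Finset.mul_sum]
          refine Finset.sum_congr rfl fun n _ => ?_
          rw [norm_mul, norm_mul, norm_pow, Real.norm_eq_abs, Real.norm_eq_abs, Real.norm_eq_abs,
            abs_of_nonneg hb0]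
          ring
      _ ≤ bump θ * (B * ‖θ‖ ^ 2) * (c * ‖θ‖ ^ 2)⁻¹ := by
          have h4 : (1 - |φ θ|)⁻¹ ≤ (c * ‖θ‖ ^ 2)⁻¹ := inv_anti₀ h1 h2
          have h5 := hDB θ
          have h6 : 0 ≤ ∑ n ∈ Finset.range N, |φ θ| ^ (n + 1) := by positivity
          have h7 := hgeom.trans h4
          gcongr
      _ = _ := by field_simp
  have hsum : Summable fun n : ℕ => ∫ θ, ‖bump θ * (φ θ ^ (n + 1) * D θ)‖ := by
    refine summable_of_sum_range_le (c := ∫ θ, B / c * bump θ)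
      (fun n => integral_nonneg fun θ => norm_nonneg _) fun N => ?_
    rw [← integral_finsetSum _ fun n _ => (hF n).norm]
    refine integral_mono_ae (integrable_finsetSum _ fun n _ => (hF n).norm)
      (integrable_bump.const_mul _) ?_
    filter_upwards [ae_ne_zero] with θ hθ using hpart N θ hθ
  have h := hasSum_integral_of_summable_integral_norm hF hsum
  have heq : ∫ θ, bump θ * (φ θ * (1 - φ θ)⁻¹ * D θ) =
      ∫ θ, ∑' n : ℕ, bump θ * (φ θ ^ (n + 1) * D θ) := by
    refine integral_congr_ae ?_
    filter_upwards [ae_ne_zero] with θ hθ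
    rcases eq_or_ne (bump θ) 0 with hb | hb
    · simp [hb]
    · rw [(((hpt θ hθ hb).mul_right (D θ)).mul_left (bump θ)).tsum_eq]
  rw [heq]
  exact h

lemma integrable_bump_mul_cos_sub_cos_mul_inv (hφ : Continuous φ) (hc : 0 < c)
    (hR : 3 * Real.pi / 2 ≤ R) (hlow : ∀ θ : ℝ × ℝ, ‖θ‖ ≤ R → c * ‖θ‖ ^ 2 ≤ 1 - |φ θ|)
    (x y : ℝ × ℝ) :
    Integrable fun θ => bump θ * ((1 - φ θ)⁻¹ * (Real.cos (dot θ x) - Real.cos (dot θ y))) := by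
  refine Integrable.bump_mul (B := 2 * (‖x‖ ^ 2 + ‖y‖ ^ 2) / c) ?_ ?_
  · exact (((continuous_const.sub hφ).measurable.inv).mul
      (continuous_cos_sub_cos x y).measurable).aestronglyMeasurable
  · filter_upwards [ae_ne_zero] with θ hθ
    rcases eq_or_ne (bump θ) 0 with hb | hb
    · simp [hb]
    obtain ⟨h1, h2⟩ := mul_sq_norm_pos_and_le_of_bump_ne_zero hR hc (hlow θ) hθ hb
    have hb0 := bump_nonneg θ
    have h3 : c * ‖θ‖ ^ 2 ≤ 1 - φ θ := by linarith [le_abs_self (φ θ)]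
    have hpos := norm_pos_iff.2 hθ
    rw [abs_mul, abs_mul, abs_inv, abs_of_nonneg hb0, abs_of_nonneg (h1.le.trans h3)]
    calc _ ≤ bump θ * ((c * ‖θ‖ ^ 2)⁻¹ * (2 * (‖x‖ ^ 2 + ‖y‖ ^ 2) * ‖θ‖ ^ 2)) := by
          gcongr
          exact abs_cos_sub_cos_le θ x y
      _ = _ := by field_simp

/-- φ/(1-φ) = 1/(1-φ) - 1, and the constant contributes zero because neither lattice point is the
origin; probabilistically, the term for time 0 vanishes. -/
lemma integral_bump_mul_geometric_eq (hφ : Continuous φ) (hc : 0 < c)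
    (hR : 3 * Real.pi / 2 ≤ R) (hlow : ∀ θ : ℝ × ℝ, ‖θ‖ ≤ R → c * ‖θ‖ ^ 2 ≤ 1 - |φ θ|)
    {x y : ℤ × ℤ} (hx : x ≠ 0) (hy : y ≠ 0) :
    ∫ θ, bump θ * (φ θ * (1 - φ θ)⁻¹ *
        (Real.cos (dot θ (toPlane x)) - Real.cos (dot θ (toPlane y)))) =
      ∫ θ, bump θ * ((1 - φ θ)⁻¹ *
        (Real.cos (dot θ (toPlane x)) - Real.cos (dot θ (toPlane y)))) := by
  have hbc : ∀ z : ℤ × ℤ, Integrable fun θ => bump θ * Real.cos (dot θ (toPlane z)) := fun z =>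
    Continuous.integrable_of_hasCompactSupport
      (by
        have : Continuous fun θ : ℝ × ℝ => dot θ (toPlane z) := by unfold dot; fun_prop
        exact continuous_bump.mul (Real.continuous_cos.comp this))
      hasCompactSupport_bump.mul_right
  have hzero : ∫ θ, bump θ *
      (Real.cos (dot θ (toPlane x)) - Real.cos (dot θ (toPlane y))) = 0 := by
    simp only [mul_sub]
    rw [integral_sub (hbc x) (hbc y), integral_bump_mul_cos, integral_bump_mul_cos, if_neg hx,
      if_neg hy, sub_zero]
  rw [← sub_zero (∫ θ, bump θ * ((1 - φ θ)⁻¹ *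
    (Real.cos (dot θ (toPlane x)) - Real.cos (dot θ (toPlane y))))), ← hzero, ← integral_sub
    (integrable_bump_mul_cos_sub_cos_mul_inv hφ hc hR hlow _ _)
    (by simpa only [mul_sub] using! (hbc x).sub (hbc y))]
  refine integral_congr_ae ?_
  filter_upwards [ae_ne_zero] with θ hθ
  rcases eq_or_ne (bump θ) 0 with hb | hb
  · simp [hb]
  obtain ⟨h1, h2⟩ := mul_sq_norm_pos_and_le_of_bump_ne_zero hR hc (hlow θ) hθ hb
  have h3 : 1 - φ θ ≠ 0 := by have := le_abs_self (φ θ); intro h; linarith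
  field_simp
  ring

end Series

/-! ### Comparison with the Gaussian model -/

lemma isSymbol_zero (k : ℕ) (a : ℝ) (U : Set (ℝ × ℝ)) : IsSymbol k a U (fun _ => 0) := by
  refine ⟨0, le_rfl, fun θ _ e => ⟨contDiffAt_const, fun i _ => ?_⟩⟩
  simp

section Comparison

variable {φ w : ℝ × ℝ → ℝ} {c R σ : ℝ} {k : ℕ}

/-- The difference between the localized potential kernel in Fourier variables and its Gaussian
counterpart. -/
noncomputable def kernelSymbol (φ : ℝ × ℝ → ℝ) (θ : ℝ × ℝ) : ℝ :=
  bump θ * (1 - φ θ)⁻¹ - gauss θ * (quad θ)⁻¹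

/-- Insert bump/q. The first difference equals -bump·w/(q(1-φ)), of order (2+σ)-2-2; the second is
(bump - gauss)/q, where the numerator has order σ because both functions equal 1 at the origin. -/
lemma isSymbol_kernelSymbol (hk : Admissible k σ) (hw : IsSymbol k (2 + σ) {0}ᶜ w)
    (hφ : ∀ θ, 1 - φ θ = quad θ + w θ) (hc : 0 < c) (hR : 3 * Real.pi / 2 < R)
    (hlow : ∀ θ : ℝ × ℝ, ‖θ‖ ≤ R → c * ‖θ‖ ^ 2 ≤ 1 - |φ θ|) :
    IsSymbol k (σ - 2) {0}ᶜ (kernelSymbol φ) := by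
  set U : Set (ℝ × ℝ) := {θ | θ ≠ 0 ∧ ‖θ‖ < R} with hU
  set V : Set (ℝ × ℝ) := {θ | 3 * Real.pi / 2 < ‖θ‖} with hV
  have hUo : IsOpen U := isOpen_ne.inter (isOpen_lt continuous_norm continuous_const)
  have hVo : IsOpen V := isOpen_lt continuous_const continuous_norm
  have hU0 : ∀ θ ∈ U, θ ≠ 0 := fun θ hθ => hθ.1
  have hUsub : U ⊆ {0}ᶜ := hU0
  have hUV : U ∪ V = {0}ᶜ := by
    ext θ
    constructor
    · rintro (h | h)
      · exact h.1
      · have h' : 3 * Real.pi / 2 < ‖θ‖ := h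
        have := Real.pi_pos
        exact norm_pos_iff.1 (by linarith)
    · intro h
      rcases lt_or_ge ‖θ‖ R with h1 | h1
      · exact Or.inl ⟨h, h1⟩
      · exact Or.inr (lt_of_lt_of_le hR h1)
  have hwU := hw.mono_set hUsub
  have hqU := (isSymbol_quad k).mono_set hUsub
  have hu : IsSymbol k 2 U (fun θ => 1 - φ θ) :=
    (hqU.add (hwU.of_le hU0 (R := R) (fun θ hθ => hθ.2.le)
      (by linarith [hk.pos]))).congr_of_isOpen hUo fun θ _ => hφ θ
  have hpos : ∀ θ ∈ U, 0 < 1 - φ θ ∧ c * ‖θ‖ ^ 2 ≤ 1 - φ θ := by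
    intro θ hθ
    have h1 := hlow θ hθ.2.le
    have h2 := le_abs_self (φ θ)
    have h3 := norm_pos_iff.2 hθ.1
    have h4 : 0 < c * ‖θ‖ ^ 2 := by positivity
    constructor <;> linarith
  have huinv : IsSymbol k (-2) U (fun θ => (1 - φ θ)⁻¹) := by
    refine hu.inv hU0 hc fun θ hθ => ?_
    rw [show ‖θ‖ ^ (2 : ℝ) = ‖θ‖ ^ 2 by exact_mod_cast Real.rpow_natCast ‖θ‖ 2,
      abs_of_pos (hpos θ hθ).1]
    exact (hpos θ hθ).2
  have hdiff : IsSymbol k (σ - 2) U (fun θ => bump θ * ((1 - φ θ)⁻¹ - (quad θ)⁻¹)) := by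
    have h1 := ((hwU.mul hU0 huinv).mul hU0 ((isSymbol_inv_quad k).mono_set hUsub)).neg
    have h2 := ((isSymbol_bump k).mono_set hUsub).mul hU0 h1
    rw [show 0 + (2 + σ + -2 + -2) = σ - 2 by ring] at h2
    refine h2.congr_of_isOpen hUo fun θ hθ => ?_
    have h3 := (hpos θ hθ).1.ne'
    have h4 := (quad_pos hθ.1).ne'
    have h5 : w θ = (1 - φ θ) - quad θ := by rw [hφ]; ring
    rw [h5]
    field_simp
    ring
  -- The lower bound on 1-φ holds only inside radius `R`; beyond the support of the bump the
  -- function is zero, and the two open sets cover the punctured plane.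
  have hdiff' : IsSymbol k (σ - 2) {0}ᶜ (fun θ => bump θ * ((1 - φ θ)⁻¹ - (quad θ)⁻¹)) := by
    rw [← hUV]
    refine hdiff.union ((isSymbol_zero k (σ - 2) V).congr_of_isOpen hVo fun θ hθ => ?_)
    rw [bump_eq_zero (le_of_lt hθ), zero_mul]
  have hsmooth : IsSymbol k (σ - 2) {0}ᶜ
      (fun θ => ((1 - gauss θ) - (1 - bump θ)) * (quad θ)⁻¹) :=
    ((isSymbol_one_sub_gauss hk).sub (isSymbol_one_sub_bump k hk.pos.le)).mul (fun θ h => h)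
      (isSymbol_inv_quad k)
  refine (hdiff'.add hsmooth).congr_of_isOpen isOpen_compl_singleton fun θ _ => ?_
  unfold kernelSymbol
  ring

/-- Near the origin `‖θ‖ ^ (σ - 2)` is integrable as `σ > 0`; outside the support of the bump only
the Gaussian term remains. -/
lemma integrable_kernelSymbol (hσ : 0 < σ) (hφ : Continuous φ)
    (hsym : IsSymbol k (σ - 2) {0}ᶜ (kernelSymbol φ)) : Integrable (kernelSymbol φ) := by
  obtain ⟨B, hB, hbound⟩ := hsym.abs_le
  have hmeas : Measurable (kernelSymbol φ) :=
    (continuous_bump.measurable.mul (continuous_const.sub hφ).measurable.inv).sub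
      (continuous_gauss.measurable.mul continuous_quad.measurable.inv)
  have hR : (2 : ℝ) ≤ 3 * Real.pi / 2 := by linarith [Real.pi_gt_three]
  have hball : MeasurableSet (Metric.closedBall (0 : ℝ × ℝ) (3 * Real.pi / 2)) :=
    Metric.isClosed_closedBall.measurableSet
  rw [← integrableOn_univ, ← Set.union_compl_self (Metric.closedBall (0 : ℝ × ℝ) (3 * Real.pi / 2))]
  refine IntegrableOn.union ?_ ?_
  · refine Integrable.mono' ((setIntegral_closedBall_norm_rpow hσ (by linarith)).1.const_mul B)
      hmeas.aestronglyMeasurable ?_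
    filter_upwards [ae_restrict_of_ae ae_ne_zero] with θ hθ using hbound θ hθ
  · refine Integrable.mono' integrable_gauss.integrableOn hmeas.aestronglyMeasurable ?_
    refine (ae_restrict_iff' hball.compl).2 (Filter.Eventually.of_forall fun θ hθ => ?_)
    have hθ' : 3 * Real.pi / 2 < ‖θ‖ := by simpa using hθ
    have h1 := sq_norm_le_quad θ
    have h2 : 1 ≤ quad θ := by nlinarith
    have h3 := gauss_pos θ
    rw [kernelSymbol, bump_eq_zero hθ'.le, zero_mul, zero_sub, norm_neg, norm_mul, norm_inv,
      Real.norm_of_nonneg h3.le, Real.norm_of_nonneg (by linarith)]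
    exact mul_le_of_le_one_right h3.le (inv_le_one_of_one_le₀ h2)

end Comparison

/-! ### Assembling the asymptotics in the Euclidean norm -/

lemma euclNorm_eq_sqrt (x : ℤ × ℤ) : euclNorm x = Real.sqrt (2 * quad (toPlane x)) := by
  unfold euclNorm quad toPlane
  congr 1
  ring

lemma euclNorm_sq (x : ℤ × ℤ) : euclNorm x ^ 2 = 2 * quad (toPlane x) := by
  rw [euclNorm_eq_sqrt, Real.sq_sqrt (mul_nonneg zero_le_two (quad_nonneg _))]

lemma euclNorm_nonneg (x : ℤ × ℤ) : 0 ≤ euclNorm x := Real.sqrt_nonneg _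

lemma one_le_euclNorm {x : ℤ × ℤ} (hx : x ≠ 0) : 1 ≤ euclNorm x := by
  have hint : 1 ≤ x.1 ^ 2 + x.2 ^ 2 := by
    by_contra! h
    have h1 : x.1 ^ 2 = 0 := by nlinarith [sq_nonneg x.1, sq_nonneg x.2]
    have h2 : x.2 ^ 2 = 0 := by nlinarith [sq_nonneg x.1, sq_nonneg x.2]
    exact hx (Prod.ext (pow_eq_zero_iff two_ne_zero |>.1 h1) (pow_eq_zero_iff two_ne_zero |>.1 h2))
  rw [euclNorm, Real.one_le_sqrt]
  exact_mod_cast hint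

lemma norm_toPlane_le_euclNorm (x : ℤ × ℤ) : ‖toPlane x‖ ≤ euclNorm x := by
  rw [← abs_of_nonneg (norm_nonneg (toPlane x)), ← abs_of_nonneg (euclNorm_nonneg x), ← sq_le_sq,
    euclNorm_sq]
  linarith [sq_norm_le_quad (toPlane x)]

lemma euclNorm_le_two_mul_norm_toPlane (x : ℤ × ℤ) : euclNorm x ≤ 2 * ‖toPlane x‖ := by
  have h0 : 0 ≤ 2 * ‖toPlane x‖ := by positivity
  rw [← abs_of_nonneg h0, ← abs_of_nonneg (euclNorm_nonneg x), ← sq_le_sq, euclNorm_sq]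
  have := quad_le (toPlane x)
  nlinarith [sq_nonneg ‖toPlane x‖]

lemma HasIdentityCovariance.integral_eq {Ω : Type*} [MeasurableSpace Ω] {P : Measure Ω}
    {Y : Ω → ℤ × ℤ} (hcov : HasIdentityCovariance P Y) (h1 : ∫ ω, ((Y ω).1 : ℝ) ∂P = 0)
    (h2 : ∫ ω, ((Y ω).2 : ℝ) ∂P = 0) :
    ∫ ω, ((Y ω).1 : ℝ) ^ 2 ∂P = 1 ∧ ∫ ω, ((Y ω).2 : ℝ) ^ 2 ∂P = 1 ∧
      ∫ ω, ((Y ω).1 : ℝ) * (Y ω).2 ∂P = 0 := by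
  obtain ⟨h11, h22, h12⟩ := hcov
  simp only [covariance, h1, h2, sub_zero] at h11 h22 h12
  exact ⟨by simpa only [sq] using h11, by simpa only [sq] using h22, h12⟩

section Walk

variable {Ω : Type*} [MeasurableSpace Ω] {P : Measure Ω} [IsProbabilityMeasure P]
  {ξ : ℕ → Ω → ℤ × ℤ} {k : ℕ} {σ : ℝ}

/-- Asymptotics of the potential kernel under a moment condition of order `2 + σ`. -/
theorem exists_potentialKernel_asymptotics (hmeas : ∀ i, Measurable (ξ i))
    (hindep : iIndepFun ξ P) (hident : ∀ i, IdentDistrib (ξ i) (ξ 0) P P)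
    (hk : Admissible k σ) (hmom : Integrable (fun ω => ‖toPlane (ξ 0 ω)‖ ^ (2 + σ)) P)
    (hmom2 : Integrable (fun ω => ‖toPlane (ξ 0 ω)‖ ^ 2) P)
    (hmean₁ : ∫ ω, ((ξ 0 ω).1 : ℝ) ∂P = 0) (hmean₂ : ∫ ω, ((ξ 0 ω).2 : ℝ) ∂P = 0)
    (hcov : HasIdentityCovariance P (ξ 0)) (hsymm : IsSymmetric P (ξ 0))
    (haper : StronglyAperiodic P (ξ 0)) :
    (∀ x : ℤ × ℤ, Summable fun n : ℕ => kernelTerm P ξ x (n + 1)) ∧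
    ∃ κ C : ℝ, 0 ≤ C ∧ ∀ x : ℤ × ℤ, x ≠ 0 →
      |potentialKernel P ξ x - (κ + 1 / Real.pi * Real.log (1 / euclNorm x))| ≤
        C * euclNorm x ^ (-σ) := by
  have hpi := Real.pi_pos
  set φ := charFn P (ξ 0) with hφdef
  have hφc : Continuous φ := continuous_charFn (hmeas 0)
  obtain ⟨h11, h22, h12⟩ := hcov.integral_eq hmean₁ hmean₂
  have hφ := one_sub_charFn_eq (hmeas 0) hmom2 h11 h22 h12
  have hw := isSymbol_integral_cosRem (measurable_toPlane_comp (hmeas 0)) hk hmom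
  -- Any radius strictly between 3π/2 (the support of the bump) and 2π would do.
  set R : ℝ := 5 * Real.pi / 3 with hRdef
  have hR : 3 * Real.pi / 2 < R := by rw [hRdef]; linarith
  obtain ⟨c, hc, hlow⟩ := exists_mul_sq_norm_le_one_sub_abs_charFn (hmeas 0) haper hk.pos hw hφ
    (R := R) (by rw [hRdef]; linarith)
  have hterm : ∀ (x : ℤ × ℤ) (n : ℕ), kernelTerm P ξ x n = ((2 * Real.pi) ^ 2)⁻¹ *
      ∫ θ, bump θ * (φ θ ^ n *
        (Real.cos (dot θ (toPlane x)) - Real.cos (dot θ (toPlane e₁)))) := by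
    intro x n
    have hi : ∀ z : ℤ × ℤ, Integrable fun θ => bump θ * (φ θ ^ n * Real.cos (dot θ (toPlane z))) :=
      fun z => Continuous.integrable_of_hasCompactSupport
        (by
          have : Continuous fun θ : ℝ × ℝ => dot θ (toPlane z) := by unfold dot; fun_prop
          exact continuous_bump.mul ((hφc.pow n).mul (Real.continuous_cos.comp this)))
        hasCompactSupport_bump.mul_right
    simp only [mul_sub]
    rw [integral_sub (hi x) (hi e₁), ← transProb_eq_integral hmeas hindep hident hsymm,
      ← transProb_eq_integral hmeas hindep hident hsymm, kernelTerm]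
    field_simp
  have hsum : ∀ x : ℤ × ℤ, HasSum (fun n : ℕ => kernelTerm P ξ x (n + 1))
      (((2 * Real.pi) ^ 2)⁻¹ * ∫ θ, bump θ * (φ θ * (1 - φ θ)⁻¹ *
        (Real.cos (dot θ (toPlane x)) - Real.cos (dot θ (toPlane e₁))))) := by
    intro x
    simp only [hterm]
    exact (hasSum_integral_pow_mul_cos_sub_cos hφc hc hR.le hlow _ _).mul_left _
  refine ⟨fun x => (hsum x).summable, ?_⟩
  have hsym := isSymbol_kernelSymbol hk hw hφ hc hR hlow
  have hHi := integrable_kernelSymbol hk.pos hφc hsym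
  obtain ⟨A, hA⟩ := hsym.exists_abs_integral_cos_mul_le hk.pos hk.lt_natCast hHi
  have he₁ : quad (toPlane e₁) = 1 / 2 := by simp [quad, toPlane, e₁]
  obtain ⟨κ, hκ⟩ := exists_gaussian_kernel_asymptotics he₁
  have he₁0 : e₁ ≠ 0 := by simp [e₁]
  set I₁ := ∫ θ, Real.cos (dot θ (toPlane e₁)) * kernelSymbol φ θ with hI₁
  -- The constant collects the Gaussian constant and the transform of the remainder at e₁. The
  -- coefficient of the logarithm is 4π/(2π)² = 1/π.
  refine ⟨((2 * Real.pi) ^ 2)⁻¹ * (κ - I₁),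
    ((2 * Real.pi) ^ 2)⁻¹ * (|A| * 2 ^ σ + 8 * Real.pi), by positivity, fun x hx => ?_⟩
  have hn1 := one_le_euclNorm hx
  have hn0 : 0 < euclNorm x := one_pos.trans_le hn1
  have hq : 2 * quad (toPlane x) = euclNorm x ^ 2 := (euclNorm_sq x).symm
  set Ix := ∫ θ, Real.cos (dot θ (toPlane x)) * kernelSymbol φ θ with hIx
  set K := ∫ θ, (Real.cos (dot θ (toPlane x)) - Real.cos (dot θ (toPlane e₁))) *
    (gauss θ * (quad θ)⁻¹) with hK
  have hG : potentialKernel P ξ x = ((2 * Real.pi) ^ 2)⁻¹ * (Ix - I₁ + K) := by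
    rw [potentialKernel, (hsum x).tsum_eq,
      integral_bump_mul_geometric_eq hφc hc hR.le hlow hx he₁0]
    congr 1
    have hF := integrable_bump_mul_cos_sub_cos_mul_inv hφc hc hR.le hlow (toPlane x) (toPlane e₁)
    have hcx := Integrable.cos_dot_mul hHi (toPlane x)
    have hce := Integrable.cos_dot_mul hHi (toPlane e₁)
    have hcxe : Integrable fun θ => Real.cos (dot θ (toPlane x)) * kernelSymbol φ θ -
        Real.cos (dot θ (toPlane e₁)) * kernelSymbol φ θ := hcx.sub hce
    have hKeq : K = (∫ θ, bump θ * ((1 - φ θ)⁻¹ *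
        (Real.cos (dot θ (toPlane x)) - Real.cos (dot θ (toPlane e₁))))) - (Ix - I₁) := by
      rw [hIx, hI₁, ← integral_sub hcx hce, ← integral_sub hF hcxe, hK]
      refine integral_congr_ae (Filter.Eventually.of_forall fun θ => ?_)
      simp only [kernelSymbol]
      ring
    rw [hKeq]
    ring
  have hIxle : |Ix| ≤ |A| * 2 ^ σ * euclNorm x ^ (-σ) := by
    have hnorm : 0 < ‖toPlane x‖ := norm_pos_iff.2 (toPlane_ne_zero hx)
    calc |Ix| ≤ A * ‖toPlane x‖ ^ (-σ) := hA _ (toPlane_ne_zero hx)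
      _ ≤ |A| * ‖toPlane x‖ ^ (-σ) := by gcongr; exact le_abs_self A
      _ ≤ |A| * (euclNorm x / 2) ^ (-σ) := by
          refine mul_le_mul_of_nonneg_left ?_ (abs_nonneg A)
          refine Real.rpow_le_rpow_of_nonpos (by positivity) ?_ (by linarith [hk.pos])
          linarith [euclNorm_le_two_mul_norm_toPlane x]
      _ = _ := by
          rw [Real.div_rpow hn0.le (by norm_num), Real.rpow_neg (by norm_num : (0 : ℝ) ≤ 2)]
          field_simp
  have hKle : |K - (κ - 4 * Real.pi * Real.log (euclNorm x))| ≤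
      8 * Real.pi * euclNorm x ^ (-σ) := by
    have h1 := hκ (toPlane x) (by nlinarith)
    rw [hq, Real.log_pow] at h1
    have h2 : 4 * Real.pi / quad (toPlane x) = 8 * Real.pi * euclNorm x ^ (-2 : ℝ) := by
      rw [Real.rpow_neg hn0.le, show euclNorm x ^ (2 : ℝ) = euclNorm x ^ 2 by
        exact_mod_cast Real.rpow_natCast (euclNorm x) 2, ← hq]
      have : quad (toPlane x) ≠ 0 := (quad_pos (toPlane_ne_zero hx)).ne'
      field_simp
      norm_num
    rw [h2] at h1
    -- The Gaussian model itself has an error of order -2, absorbed here because `σ ≤ 2` and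
    -- `euclNorm x ≥ 1`.
    have h3 : euclNorm x ^ (-2 : ℝ) ≤ euclNorm x ^ (-σ) :=
      Real.rpow_le_rpow_of_exponent_le hn1 (by linarith [hk.le_two])
    calc _ = |K - (κ - 2 * Real.pi * ((2 : ℕ) * Real.log (euclNorm x)))| := by
          congr 2; push_cast; ring
      _ ≤ 8 * Real.pi * euclNorm x ^ (-2 : ℝ) := h1
      _ ≤ _ := by gcongr
  have herr : potentialKernel P ξ x - (((2 * Real.pi) ^ 2)⁻¹ * (κ - I₁) +
      1 / Real.pi * Real.log (1 / euclNorm x)) = ((2 * Real.pi) ^ 2)⁻¹ *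
      (Ix + (K - (κ - 4 * Real.pi * Real.log (euclNorm x)))) := by
    rw [hG, one_div (euclNorm x), Real.log_inv]
    field_simp
    ring
  rw [herr, abs_mul, abs_of_pos (by positivity : 0 < ((2 * Real.pi) ^ 2)⁻¹)]
  calc _ ≤ ((2 * Real.pi) ^ 2)⁻¹ *
        (|Ix| + |K - (κ - 4 * Real.pi * Real.log (euclNorm x))|) := by
        gcongr
        exact abs_add_le _ _
    _ ≤ ((2 * Real.pi) ^ 2)⁻¹ * (|A| * 2 ^ σ * euclNorm x ^ (-σ) +
        8 * Real.pi * euclNorm x ^ (-σ)) := by gcongr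
    _ = _ := by ring

end Walk

lemma integrable_norm_rpow_of_le {Ω : Type*} [MeasurableSpace Ω] {P : Measure Ω}
    [IsProbabilityMeasure P] {Y : Ω → ℤ × ℤ} (hY : Measurable Y) {p q : ℝ} (hp : 0 ≤ p)
    (hpq : p ≤ q) (hint : Integrable (fun ω => euclNorm (Y ω) ^ q) P) :
    Integrable (fun ω => ‖toPlane (Y ω)‖ ^ p) P := by
  refine ((integrable_const (1 : ℝ)).add hint).mono'
    (measurable_comp_lattice hY fun z => ‖toPlane z‖ ^ p).aestronglyMeasurable
    (Filter.Eventually.of_forall fun ω => ?_)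
  have h0 := norm_nonneg (toPlane (Y ω))
  have h1 := norm_toPlane_le_euclNorm (Y ω)
  rw [Real.norm_of_nonneg (by positivity), Pi.add_apply]
  have h2 : 0 ≤ euclNorm (Y ω) ^ q := Real.rpow_nonneg (euclNorm_nonneg _) _
  rcases le_total ‖toPlane (Y ω)‖ 1 with h | h
  · have := Real.rpow_le_one h0 h hp
    linarith
  · have h3 := Real.rpow_le_rpow_of_exponent_le h hpq
    have h4 := Real.rpow_le_rpow h0 h1 (hp.trans hpq)
    linarith

end PlanarWalk

theorem lemma2p3 {Ω : Type*} [MeasurableSpace Ω] (P : Measure Ω) [IsProbabilityMeasure P]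
    (ξ : ℕ → Ω → ℤ × ℤ)
    (hmeas : ∀ i, Measurable (ξ i))
    (hindep : iIndepFun ξ P)
    (hident : ∀ i, IdentDistrib (ξ i) (ξ 0) P P)
    (δ : ℝ) (hδ : 0 < δ)
    (hmoment : Integrable (fun ω => PlanarWalk.euclNorm (ξ 0 ω) ^ (2 + δ)) P)
    (hmean₁ : ∫ ω, ((ξ 0 ω).1 : ℝ) ∂P = 0)
    (hmean₂ : ∫ ω, ((ξ 0 ω).2 : ℝ) ∂P = 0)
    (hcov : PlanarWalk.HasIdentityCovariance P (ξ 0))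
    (hsymm : PlanarWalk.IsSymmetric P (ξ 0))
    (haper : PlanarWalk.StronglyAperiodic P (ξ 0)) :
    (∀ x : ℤ × ℤ, Summable (fun n : ℕ => PlanarWalk.kernelTerm P ξ x (n + 1))) ∧
    ∃ κ : ℝ, ∀ ρ : ℝ, ρ < δ / 2 → ρ ≤ 2 →
      ∃ C : ℝ, ∀ x : ℤ × ℤ, x ≠ 0 →
        |PlanarWalk.potentialKernel P ξ x
            - (κ + 1 / Real.pi * Real.log (1 / PlanarWalk.euclNorm x))|
          ≤ C * PlanarWalk.euclNorm x ^ (-ρ) := by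
  -- For `δ < 2`, one derivative with `σ = δ / 2 < 1` reaches every required exponent; for `δ ≥ 2`,
  -- fourth moments are available and `σ = 2` with three derivatives covers all `ρ ≤ 2`. Since `σ`
  -- does not depend on `ρ`, neither do κ and `C`.
  obtain ⟨k, σ, hk, hσδ, hρσ⟩ : ∃ (k : ℕ) (σ : ℝ), PlanarWalk.Admissible k σ ∧ σ ≤ δ ∧
      ∀ ρ : ℝ, ρ < δ / 2 → ρ ≤ 2 → ρ ≤ σ := by
    rcases lt_or_ge δ 2 with h | h
    · exact ⟨1, δ / 2, Or.inl ⟨rfl, by linarith, by linarith⟩, by linarith,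
        fun ρ hρ _ => hρ.le⟩
    · exact ⟨3, 2, Or.inr ⟨rfl, rfl⟩, h, fun ρ _ hρ => hρ⟩
  have hmom := PlanarWalk.integrable_norm_rpow_of_le (hmeas 0) (p := 2 + σ)
    (by linarith [hk.pos]) (by linarith) hmoment
  have hmom2 := PlanarWalk.integrable_norm_rpow_of_le (hmeas 0) (p := 2)
    (by norm_num) (by linarith) hmoment
  obtain ⟨hsum, κ, C, hC, h⟩ := PlanarWalk.exists_potentialKernel_asymptotics hmeas hindep hident
    hk hmom (by exact_mod_cast hmom2) hmean₁ hmean₂ hcov hsymm haper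
  refine ⟨hsum, κ, fun ρ hρ hρ2 => ⟨C, fun x hx => (h x hx).trans ?_⟩⟩
  gcongr
  · exact PlanarWalk.one_le_euclNorm hx
  · exact hρσ ρ hρ hρ2
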